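/- Let $\alpha_p,\alpha_n<1$ with $\alpha_p,\alpha_n\neq 0$, let $\beta_p>1$, $\beta_n>0$, $c_p,c_n>0$, $b>0$, $x_0\in\mathbb R$. Let $L$ be a bilateral classic tempered stable (BCTS) Lévy process of finite variation, i.e. a driftless càdlàg Lévy process with $\mathbb E[e^{iuL(t)}]=\exp\big(t\int_{\mathbb R}(e^{iux}-1)\,\nu(x)\,dx\big)$, where $$\nu(x)=c_p\frac{e^{-\beta_p x}}{x^{1+\alpha_p}}\mathbf 1_{x>0}+c_n\frac{e^{\beta_n x}}{|x|^{1+\alpha_n}}\mathbf 1_{x<0}.$$ Let $X$ be the OU-BCTS process solving $dX(t)=-bX(t)\,dt+dL(t)$, $X(0)=x_0$. Let the spot price be $S(t)=F(0,t)\,e^{h(t)+X(t)}$, with $F(0,t)\neq0$ and $h$ deterministic. Put $m_X(s,t)=\ln\mathbb E[e^{sX(t)}]$, $a=e^{-bt}$ and $\tilde I(s,\alpha,\beta_1,\beta_2)=\int_{\beta_1}^{\beta_2}z^{-1-\alpha}(z-s)^{\alpha}\,dz$. Then for every $t\ge 0$: (i) for $-\beta_n<s<\beta_p$ the variable $e^{sX(t)}$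 is integrable and $$m_X(s,t)=s\,x_0e^{-bt}-\frac{c_p\beta_p^{\alpha_p}\Gamma(1-\alpha_p)}{\alpha_p b}\Big[\tilde I\big(s,\alpha_p,\beta_p,\tfrac{\beta_p}{a}\big)+\log a\Big]-\frac{c_n\beta_n^{\alpha_n}\Gamma(1-\alpha_n)}{\alpha_n b}\Big[\tilde I\big(-s,\alpha_n,\beta_n,\tfrac{\beta_n}{a}\big)+\log a\Big];$$ (ii) $S(t)$ is integrable, and $\mathbb E[S(t)]=F(0,t)$ (consistency with the forward curve) holds if and only if $h(t)=-m_X(1,t)$, that is, if and only if $$h(t)=-x_0e^{-bt}+\frac{c_p\beta_p^{\alpha_p}\Gamma(1-\alpha_p)}{\alpha_p b}\Big[\tilde I\big(1,\alpha_p,\beta_p,\tfrac{\beta_p}{a}\big)+\log a\Big]+\frac{c_n\beta_n^{\alpha_n}\Gamma(1-\alpha_n)}{\alpha_n b}\Big[\tilde I\big(-1,\alpha_n,\beta_n,\tfrac{\beta_n}{a}\big)+\log a\Big].$$ Moreover, when $\alpha_p=\alpha_n=\tfrac12$ the integrals are elementary: for $\beta_1,\beta_2>1$, $$\tilde I\big(1,\tfrac12,\beta_1,\beta_2\big)=2\Big(\log\big(\sqrt{\beta_2}+\sqrt{\beta_2-1}\big)-\sqrt{\tfrac{\beta_2-1}{\beta_2}}\Big)-2\Big(\log\big(\sqrt{\beta_1}+\sqrt{\beta_1-1}\big)-\sqrt{\tfrac{\beta_1-1}{\beta_1}}\Big),$$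 and for $\beta_1,\beta_2>0$, $$\tilde I\big(-1,\tfrac12,\beta_1,\beta_2\big)=2\Big(\log\big(\sqrt{\beta_2}+\sqrt{\beta_2+1}\big)-\sqrt{\tfrac{\beta_2+1}{\beta_2}}\Big)-2\Big(\log\big(\sqrt{\beta_1}+\sqrt{\beta_1+1}\big)-\sqrt{\tfrac{\beta_1+1}{\beta_1}}\Big).$$ -/

import Mathlib

open MeasureTheory ProbabilityTheory Filter Topology
open scoped NNReal

noncomputable section

/-- Density of the Lévy measure of a bilateral classic tempered stable (BCTS) law:
`cp * exp (-βp x) / x ^ (1 + αp)` for `x > 0` and `cn * exp (βn x) / |x| ^ (1 + αn)` for `x < 0`. -/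
def bctsLevyDensity (αp αn βp βn cp cn : ℝ) (x : ℝ) : ℝ :=
  if 0 < x then cp * Real.exp (-βp * x) / x ^ (1 + αp)
  else if x < 0 then cn * Real.exp (βn * x) / |x| ^ (1 + αn)
  else 0

/-- Logarithmic characteristic (at time one) of the driftless finite variation BCTS Lévy process:
the Lévy–Khintchine exponent `∫ (exp (i u x) - 1) ν(x) dx`. -/
def bctsExponent (αp αn βp βn cp cn : ℝ) (u : ℝ) : ℂ :=
  ∫ x : ℝ, (Complex.exp (Complex.I * u * x) - 1) * (bctsLevyDensity αp αn βp βn cp cn x : ℂ)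

/-- `f` is right-continuous with left limits. -/
def IsCadlagPath (f : ℝ≥0 → ℝ) : Prop :=
  ∀ t, ContinuousWithinAt f (Set.Ici t) t ∧ ∃ l, Tendsto f (𝓝[<] t) (𝓝 l)

/-- `L` is a BCTS Lévy process: it starts at zero, has independent and stationary increments and
càdlàg paths, and its one-dimensional laws have the characteristic function
`exp (t ψ(u))` with `ψ` the exponent above. -/
structure IsBCTSLevyProcess {Ω : Type*} [MeasurableSpace Ω] (P : Measure Ω)
    (αp αn βp βn cp cn : ℝ) (L : ℝ≥0 → Ω → ℝ) : Prop where
  aemeasurable : ∀ t, AEMeasurable (L t) P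
  start_zero : ∀ᵐ ω ∂P, L 0 ω = 0
  indep_increments : HasIndepIncrements L P
  stationary_increments : ∀ s h : ℝ≥0, IdentDistrib (fun ω => L (s + h) ω - L s ω) (L h) P P
  cadlag : ∀ᵐ ω ∂P, IsCadlagPath (fun t => L t ω)
  charFun_eq : ∀ (t : ℝ≥0) (u : ℝ),
    charFun (P.map (L t)) u = Complex.exp (t * bctsExponent αp αn βp βn cp cn u)

/-- `X` is the Ornstein–Uhlenbeck process driven by `L` with mean reversion rate `b` and initial
value `x₀`, that is, the solution of `dX(t) = -b X(t) dt + dL(t)`, `X(0) = x₀`.  The noise is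
additive, so the equation reads `X(t) = x₀ - b ∫₀ᵗ X(s) ds + L(t)` for all `t`, almost surely
(with `L(0) = 0`); its solution is `X(t) = x₀ exp (-b t) + ∫₀ᵗ exp (-b (t - s)) dL(s)`. -/
def IsOUProcess {Ω : Type*} [MeasurableSpace Ω] (P : Measure Ω) (b x₀ : ℝ)
    (L X : ℝ≥0 → Ω → ℝ) : Prop :=
  ∀ᵐ ω ∂P, ∀ t : ℝ≥0,
    IntervalIntegrable (fun s : ℝ => X s.toNNReal ω) volume 0 t ∧
    X t ω = x₀ - b * (∫ s in (0 : ℝ)..t, X s.toNNReal ω) + L t ω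

/-- Spot price `S(t) = F(0,t) exp (h(t) + X(t))`, where `F₀ t` stands for `F(0,t)`. -/
def spotPrice {Ω : Type*} (F₀ h : ℝ≥0 → ℝ) (X : ℝ≥0 → Ω → ℝ) (t : ℝ≥0) (ω : Ω) : ℝ :=
  F₀ t * Real.exp (h t + X t ω)

/-- `Ĩ(s, α, β₁, β₂) = ∫_{β₁}^{β₂} z ^ (-1 - α) (z - s) ^ α dz`. -/
def tildeI (s α β₁ β₂ : ℝ) : ℝ :=
  ∫ z in β₁..β₂, z ^ (-1 - α) * (z - s) ^ α

/-- The explicit form of `m_Z(s, t)`, the cumulant generating function of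
`Z(t) = ∫₀ᵗ exp (-b (t - s)) dL(s)`, with `a = exp (-b t)`. -/
def ouBctsCgf (αp αn βp βn cp cn b s t : ℝ) : ℝ :=
  -(cp * βp ^ αp * Real.Gamma (1 - αp) / (αp * b)) *
      (tildeI s αp βp (βp / Real.exp (-b * t)) + Real.log (Real.exp (-b * t)))
    - (cn * βn ^ αn * Real.Gamma (1 - αn) / (αn * b)) *
      (tildeI (-s) αn βn (βn / Real.exp (-b * t)) + Real.log (Real.exp (-b * t)))

end

/-! Write `X(t) = x₀ e^{-bt} + Z(t)`, with `Z(t)` the integral of `e^{-b(t-r)}` against `L`.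
Everything reduces to the cumulant of `Z(t)`: since `F(0,t) ≠ 0` and `E[S(t)] = F(0,t) exp(h(t) +
m_X(1,t))`, consistency is the vanishing of that exponent.

No stochastic integration is used. Pathwise, variation of constants (`ou_equation_solution`) and
Abel summation exhibit `Z(t)` as an almost sure limit of weighted sums of increments of `L`. Their
characteristic functions are exponentials of Riemann sums, so that of `Z(t)` is `exp ∫₀ᵗ ψ(u
e^{-bv}) dv` (`IsOUProcess.charFun_eq`). This is again of Lévy–Khintchine form, with the measure
`ouLevyMeasure`.

A characteristic function does not by itself provide exponential moments. Here it extends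
holomorphically and boundedly to the strip between `0` and `s`; damping `e^{sx}` by a Gaussian,
shifting a contour and removing the damping by monotone convergence yields both finiteness and the
value (`integrable_exp_mul_of_charFun_extension`).

Finally, differentiating the one-sided tempered stable cumulant in `s` leaves a Gamma integral, so
it equals `-(c Γ(1-α)/α)((β-s)^α - β^α)`. Its time integral along `s e^{-bv}` becomes `tildeI`
through `z = β e^{bv}`. -/

/-! ### Exponential moments by analytic continuation of the characteristic function -/

/-- Shifting the contour of integration between two vertical lines, for a function holomorphic in
the strip between them and with Gaussian decay. -/
theorem integral_vertical_line_shift {G : ℂ → ℂ} {s C c : ℝ} (hc : 0 < c)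
    (hd : DifferentiableOn ℂ G {z | z.re ∈ Set.uIcc 0 s})
    (hb : ∀ z : ℂ, z.re ∈ Set.uIcc 0 s → ‖G z‖ ≤ C * Real.exp (-c * z.im ^ 2)) :
    ∫ y : ℝ, G (y * Complex.I) = ∫ y : ℝ, G (s + y * Complex.I) := by
  have hint : ∀ σ ∈ Set.uIcc 0 s, Integrable (fun y : ℝ => G (σ + y * Complex.I)) := by
    intro σ hσ
    refine Integrable.mono' ((integrable_exp_neg_mul_sq hc).const_mul C) ?_ ?_
    · refine Continuous.aestronglyMeasurable ?_
      rw [← continuousOn_univ]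
      refine hd.continuousOn.comp (by fun_prop) ?_
      intro y _
      simpa using hσ
    · refine ae_of_all _ fun y => ?_
      simpa using hb (σ + y * Complex.I) (by simpa using hσ)
  have hrect : ∀ T : ℝ,
      (∫ y in (-T)..T, G (s + y * Complex.I)) - ∫ y in (-T)..T, G ((0 : ℝ) + y * Complex.I)
        = Complex.I * ((∫ x in (0 : ℝ)..s, G (x + (-T : ℝ) * Complex.I))
            - ∫ x in (0 : ℝ)..s, G (x + T * Complex.I)) := by
    intro T
    have h := Complex.integral_boundary_rect_eq_zero_of_differentiableOn G
      (-T * Complex.I) (s + T * Complex.I) (hd.mono ?_)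
    · simp at h
      have hI := Complex.I_mul_I
      simp only [Complex.ofReal_neg, Complex.ofReal_zero, zero_add, neg_mul]
      linear_combination (-Complex.I) * h + ((∫ (y : ℝ) in -T..T, G (y * Complex.I)) -
        (∫ (y : ℝ) in -T..T, G (s + y * Complex.I))) * (-hI)
    · intro z hz
      have := hz.1
      simpa using this
  have htop : Tendsto (fun T : ℝ => Real.exp (-c * T ^ 2)) atTop (𝓝 0) := by
    have h1 : Tendsto (fun T : ℝ => c * T ^ 2) atTop atTop :=
      (tendsto_pow_atTop two_ne_zero).const_mul_atTop hc
    simpa [Function.comp_def] using Real.tendsto_exp_neg_atTop_nhds_zero.comp h1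
  -- The sign `ε = ±1` treats both horizontal sides of the rectangle at once.
  have hhor : ∀ ε : ℝ, |ε| = 1 →
      Tendsto (fun T : ℝ => ∫ x in (0 : ℝ)..s, G (x + (ε * T : ℝ) * Complex.I)) atTop (𝓝 0) := by
    intro ε hε
    have hε2 : ε ^ 2 = 1 := by rw [← sq_abs, hε, one_pow]
    refine squeeze_zero_norm (a := fun T : ℝ => C * Real.exp (-c * T ^ 2) * |s - 0|) ?_ ?_
    · intro T
      refine intervalIntegral.norm_integral_le_of_norm_le_const fun x hx => ?_
      have := hb (x + (ε * T : ℝ) * Complex.I) (by simpa using Set.uIoc_subset_uIcc hx)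
      simpa [mul_pow, hε2] using this
    · simpa using (htop.const_mul C).mul_const |s - 0|
  have h1 := intervalIntegral_tendsto_integral (hint s Set.right_mem_uIcc)
    tendsto_neg_atTop_atBot tendsto_id
  have h0 := intervalIntegral_tendsto_integral (hint 0 Set.left_mem_uIcc)
    tendsto_neg_atTop_atBot tendsto_id
  have h2 := ((hhor (-1) (by simp)).sub (hhor 1 (by simp))).const_mul Complex.I
  have h3 := (h1.sub h0).congr hrect
  simp only [neg_mul, one_mul, sub_zero, mul_zero] at h2
  have h4 := tendsto_nhds_unique h3 h2
  simp only [Complex.ofReal_zero, zero_add] at h4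
  exact (sub_eq_zero.mp h4).symm

/-- The Gaussian damping `exp (s x - x² / (4 N))` as a superposition of characters. -/
theorem integral_cexp_mul_I_mul_gaussian {N : ℝ} (hN : 0 < N) (s x : ℝ) :
    ∫ v : ℝ, Complex.exp (v * x * Complex.I) * Complex.exp (N * (v * Complex.I - s) ^ 2)
      = (√(Real.pi / N) * Real.exp (s * x - x ^ 2 / (4 * N)) : ℝ) := by
  -- Expanding `N (v i - s)²` gives a cross term `-2 N s v i`, which is absorbed into the frequency,
  -- hence the shift of `x` by `2 N s`.
  have h := fourierIntegral_gaussian (b := N) (by simpa using hN) (x - 2 * N * s)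
  have hsq : ((Real.pi / N : ℝ) : ℂ) ^ (1 / 2 : ℂ) = (√(Real.pi / N) : ℝ) := by
    rw [Real.sqrt_eq_rpow, Complex.ofReal_cpow (by positivity)]
    norm_num
  have hN' : (N : ℂ) ≠ 0 := by exact_mod_cast hN.ne'
  calc _ = ∫ v : ℝ, Complex.exp (N * s ^ 2) *
        (Complex.exp (Complex.I * (x - 2 * N * s) * v) * Complex.exp (-N * v ^ 2)) := by
        congr 1; ext v
        rw [← Complex.exp_add, ← Complex.exp_add, ← Complex.exp_add]
        congr 1
        linear_combination (N * v ^ 2 : ℂ) * Complex.I_sq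
    _ = _ := by
        rw [integral_const_mul, h]
        push_cast at hsq ⊢
        rw [hsq, mul_left_comm, ← Complex.exp_add]
        congr 2
        field_simp
        ring

/-- If the characteristic function of a probability measure extends to a bounded holomorphic
function in the strip `re z ∈ [0, s]`, then the measure has a finite exponential moment of order
`s`, given by the extension. -/
theorem integrable_exp_mul_of_charFun_extension {μ : Measure ℝ} [IsProbabilityMeasure μ]
    {F : ℂ → ℂ} {s C : ℝ} (hd : DifferentiableOn ℂ F {z | z.re ∈ Set.uIcc 0 s})
    (hb : ∀ z : ℂ, z.re ∈ Set.uIcc 0 s → ‖F z‖ ≤ C)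
    (hF : ∀ u : ℝ, charFun μ u = F (u * Complex.I)) :
    Integrable (fun x => Real.exp (s * x)) μ ∧ ((∫ x, Real.exp (s * x) ∂μ : ℝ) : ℂ) = F s := by
  have hpi : (0 : ℝ) < √Real.pi := by positivity
  have hdampint : ∀ n : ℕ, Integrable
      (fun x => Real.exp (s * x - x ^ 2 / (4 * ((n : ℝ) + 1) ^ 2))) μ := by
    intro n
    refine Integrable.of_bound (C := Real.exp (s ^ 2 * ((n : ℝ) + 1) ^ 2)) (by fun_prop)
      (ae_of_all _ fun x => ?_)
    rw [Real.norm_eq_abs, Real.abs_exp, Real.exp_le_exp]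
    have : (0 : ℝ) < 4 * ((n : ℝ) + 1) ^ 2 := by positivity
    rw [sub_le_iff_le_add, ← sub_le_iff_le_add', le_div_iff₀ this]
    nlinarith [sq_nonneg (x - 2 * s * ((n : ℝ) + 1) ^ 2)]
  -- Fubini turns the damped moment into an integral of `F` along the imaginary axis; moving it to
  -- `re z = s` and rescaling by `m = n + 1` leaves a fixed Gaussian weight, with the argument of
  -- `F` concentrating at `s`.
  have key : ∀ n : ℕ, ((∫ x, Real.exp (s * x - x ^ 2 / (4 * ((n : ℝ) + 1) ^ 2)) ∂μ : ℝ) : ℂ)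
      = (√Real.pi : ℝ)⁻¹ *
        ∫ w : ℝ, F (s + (w / ((n : ℝ) + 1) : ℝ) * Complex.I) * (Real.exp (-w ^ 2) : ℝ) := by
    intro n
    set m : ℝ := (n : ℝ) + 1 with hm
    have hm0 : 0 < m := by positivity
    have hN : 0 < m ^ 2 := by positivity
    set G : ℂ → ℂ := fun z => F z * Complex.exp ((m ^ 2 : ℝ) * (z - s) ^ 2) with hG
    have hnorm : ∀ z : ℂ, ‖Complex.exp ((m ^ 2 : ℝ) * (z - s) ^ 2)‖
        = Real.exp (m ^ 2 * (z.re - s) ^ 2) * Real.exp (-(m ^ 2) * z.im ^ 2) := by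
      intro z
      rw [Complex.norm_exp, ← Real.exp_add, Complex.re_ofReal_mul]
      congr 1
      simp [sq]
      ring
    have hshift := integral_vertical_line_shift (G := G) (s := s)
      (C := C * Real.exp (m ^ 2 * s ^ 2)) hN (hd.mul (by fun_prop)) ?_
    swap
    · intro z hz
      rw [hG, norm_mul, hnorm, mul_assoc]
      refine mul_le_mul (hb z hz) ?_ (by positivity) ((norm_nonneg _).trans (hb z hz))
      gcongr ?_ * _
      rw [Real.exp_le_exp]
      have h1 : |z.re - s| ≤ |0 - s| := by
        have := Set.abs_sub_right_of_mem_uIcc hz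
        rw [abs_sub_comm]; simpa using this
      have h2 := sq_le_sq' (abs_le.mp (h1)).1 (abs_le.mp (h1)).2
      rw [sq_abs] at h2
      have : (0 - s) ^ 2 = s ^ 2 := by ring
      rw [this] at h2
      gcongr
    have hfub : (∫ x, ((√(Real.pi / m ^ 2) * Real.exp (s * x - x ^ 2 / (4 * m ^ 2)) : ℝ) : ℂ) ∂μ)
        = ∫ v : ℝ, G (v * Complex.I) := by
      simp_rw [← integral_cexp_mul_I_mul_gaussian hN, hG]
      rw [integral_integral_swap]
      · congr 1; ext v
        rw [integral_mul_const, ← hF, charFun_apply_real]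
      · have h1 : Integrable (fun v : ℝ => Real.exp (m ^ 2 * s ^ 2) *
            Real.exp (-(m ^ 2) * v ^ 2)) := (integrable_exp_neg_mul_sq hN).const_mul _
        refine (h1.comp_snd μ).mono' ?_ (ae_of_all _ fun p => ?_)
        · refine Continuous.aestronglyMeasurable ?_
          fun_prop
        · simp only [Function.uncurry]
          rw [norm_mul, hnorm, ← Complex.ofReal_mul, Complex.norm_exp_ofReal_mul_I]
          simp
    rw [hshift] at hfub
    have hscale : ∫ y : ℝ, G (s + y * Complex.I)
        = (m⁻¹ : ℝ) *
          ∫ w : ℝ, F (s + (w / m : ℝ) * Complex.I) * (Real.exp (-w ^ 2) : ℝ) := by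
      have := Measure.integral_comp_div (fun y : ℝ => G (s + y * Complex.I)) m
      rw [abs_of_pos hm0] at this
      have h2 : ∀ w : ℝ, G (s + (w / m : ℝ) * Complex.I)
          = F (s + (w / m : ℝ) * Complex.I) * (Real.exp (-w ^ 2) : ℝ) := by
        intro w
        simp only [hG]
        congr 1
        push_cast
        congr 1
        have : (m : ℂ) ≠ 0 := by exact_mod_cast hm0.ne'
        field_simp
        linear_combination (w ^ 2 : ℂ) * Complex.I_sq
      simp_rw [h2] at this
      rw [this, Complex.real_smul, ← mul_assoc, ← Complex.ofReal_mul, inv_mul_cancel₀ hm0.ne']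
      simp
    rw [hscale, integral_complex_ofReal, integral_const_mul, Complex.ofReal_mul,
      Real.sqrt_div' _ hN.le, Real.sqrt_sq hm0.le] at hfub
    have hm' : (m : ℂ) ≠ 0 := by exact_mod_cast hm0.ne'
    have hpi' : ((√Real.pi : ℝ) : ℂ) ≠ 0 := by exact_mod_cast hpi.ne'
    generalize (∫ w : ℝ, F (s + (w / m : ℝ) * Complex.I) * (Real.exp (-w ^ 2) : ℝ)) = J at hfub ⊢
    rw [Complex.ofReal_div, Complex.ofReal_inv] at hfub
    rw [Complex.ofReal_inv]
    field_simp at hfub ⊢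
    exact hfub
  have hlim : Tendsto (fun n : ℕ =>
      ((∫ x, Real.exp (s * x - x ^ 2 / (4 * ((n : ℝ) + 1) ^ 2)) ∂μ : ℝ) : ℂ)) atTop (𝓝 (F s)) := by
    simp_rw [key]
    have hmem : ∀ y : ℝ, (s + y * Complex.I) ∈ {z : ℂ | z.re ∈ Set.uIcc 0 s} := by
      intro y; simp
    have hcont : Continuous fun y : ℝ => F (s + y * Complex.I) := by
      rw [← continuousOn_univ]
      exact hd.continuousOn.comp (by fun_prop) fun y _ => hmem y
    have h1 : Tendsto (fun n : ℕ =>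
        ∫ w : ℝ, F (s + (w / ((n : ℝ) + 1) : ℝ) * Complex.I) * (Real.exp (-w ^ 2) : ℝ)) atTop
        (𝓝 (∫ w : ℝ, F s * (Real.exp (-w ^ 2) : ℝ))) := by
      refine tendsto_integral_of_dominated_convergence
        (fun w => C * Real.exp (-1 * w ^ 2)) ?_ ?_ ?_ ?_
      · intro n
        exact ((hcont.comp (by fun_prop : Continuous fun w : ℝ => w / ((n : ℝ) + 1))).mul
          (by fun_prop)).aestronglyMeasurable
      · exact (integrable_exp_neg_mul_sq one_pos).const_mul C
      · intro n
        refine ae_of_all _ fun w => ?_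
        rw [norm_mul, Complex.norm_real, Real.norm_eq_abs, Real.abs_exp, neg_one_mul]
        gcongr
        exact hb _ (hmem _)
      · refine ae_of_all _ fun w => ?_
        refine Tendsto.mul_const _ ?_
        have h2 : Tendsto (fun n : ℕ => w / ((n : ℝ) + 1)) atTop (𝓝 0) :=
          Tendsto.const_div_atTop (tendsto_natCast_atTop_atTop.atTop_add tendsto_const_nhds) w
        have h3 := (hcont.tendsto 0).comp h2
        simpa [Function.comp_def] using h3
    have h2 : ∫ w : ℝ, F s * (Real.exp (-w ^ 2) : ℝ) = F s * (√Real.pi : ℝ) := by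
      rw [integral_const_mul, integral_complex_ofReal]
      have := integral_gaussian 1
      simp only [neg_mul, one_mul, div_one] at this
      rw [this]
    rw [h2] at h1
    have hpi' : ((√Real.pi : ℝ) : ℂ) ≠ 0 := by exact_mod_cast hpi.ne'
    have h3 := h1.const_mul (((√Real.pi : ℝ) : ℂ)⁻¹)
    rw [mul_comm (F s), inv_mul_cancel_left₀ hpi'] at h3
    simpa only [Complex.ofReal_inv] using h3
  have hre : Tendsto (fun n : ℕ =>
      ∫ x, Real.exp (s * x - x ^ 2 / (4 * ((n : ℝ) + 1) ^ 2)) ∂μ) atTop (𝓝 (F s).re) :=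
    (Complex.continuous_re.tendsto _).comp hlim
  have hFs : F s = ((F s).re : ℂ) :=
    tendsto_nhds_unique hlim ((Complex.continuous_ofReal.tendsto _).comp hre)
  -- The damping factors increase to `1`, so monotone convergence gives finiteness of the undamped
  -- moment, which is not known beforehand.
  have hmono := lintegral_tendsto_of_tendsto_of_monotone (μ := μ)
    (f := fun n : ℕ => fun x : ℝ =>
      ENNReal.ofReal (Real.exp (s * x - x ^ 2 / (4 * ((n : ℝ) + 1) ^ 2))))
    (F := fun x => ENNReal.ofReal (Real.exp (s * x))) (fun n => by fun_prop) ?_ ?_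
  rotate_left
  · refine ae_of_all _ fun x n k hnk => ?_
    dsimp only
    gcongr
  · refine ae_of_all _ fun x => ENNReal.tendsto_ofReal ?_
    refine (Real.continuous_exp.tendsto _).comp ?_
    have h1 : Tendsto (fun n : ℕ => 4 * ((n : ℝ) + 1) ^ 2) atTop atTop :=
      ((tendsto_pow_atTop two_ne_zero).comp
        (tendsto_natCast_atTop_atTop.atTop_add tendsto_const_nhds)).const_mul_atTop four_pos
    simpa using (h1.const_div_atTop (x ^ 2)).const_sub (s * x)
  have hlint : ∫⁻ x, ENNReal.ofReal (Real.exp (s * x)) ∂μ = ENNReal.ofReal (F s).re := by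
    refine tendsto_nhds_unique hmono ((ENNReal.tendsto_ofReal hre).congr fun n => ?_)
    exact ofReal_integral_eq_lintegral_ofReal (hdampint n) (ae_of_all _ fun x => by positivity)
  have hnn : 0 ≤ (F s).re := ge_of_tendsto' hre fun n => integral_nonneg fun x => by positivity
  have hmeas : AEStronglyMeasurable (fun x : ℝ => Real.exp (s * x)) μ := by fun_prop
  refine ⟨⟨hmeas, ?_⟩, ?_⟩
  · rw [hasFiniteIntegral_iff_ofReal (ae_of_all _ fun x => by positivity), hlint]
    exact ENNReal.ofReal_lt_top
  · rw [integral_eq_lintegral_of_nonneg_ae (ae_of_all _ fun x => by positivity) hmeas, hlint,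
      ENNReal.toReal_ofReal hnn, ← hFs]

/-! ### Lévy–Khintchine exponents on a strip -/

noncomputable section

/-- The driftless Lévy–Khintchine exponent `∫ (exp (z x) - 1) ν(dx)` of a Lévy measure `ν`. -/
def levyExponent (ν : Measure ℝ) (z : ℂ) : ℂ :=
  ∫ x : ℝ, (Complex.exp (z * x) - 1) ∂ν

/-- `ν` integrates `|x| exp (σ x)` for all `σ` in the open interval `(a, b)`, which contains `0`:
the exponent of `ν` is then holomorphic in the strip `a < re z < b`. -/
structure HasLevyStrip (ν : Measure ℝ) (a b : ℝ) : Prop where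
  zero_mem : (0 : ℝ) ∈ Set.Ioo a b
  integrable : ∀ σ ∈ Set.Ioo a b, Integrable (fun x : ℝ => |x| * Real.exp (σ * x)) ν

end

/-- Mean value inequality on the half-plane `re ≤ max 0 (re w)`, which is convex and contains `0`
and `w`. The factor `‖w‖` is what tames the singularity of a Lévy measure at the origin. -/
theorem Complex.norm_exp_sub_one_le_mul (w : ℂ) :
    ‖Complex.exp w - 1‖ ≤ ‖w‖ * (1 + Real.exp w.re) := by
  have h := (convex_halfSpace_re_le (max 0 w.re)).norm_image_sub_le_of_norm_deriv_le (𝕜 := ℂ)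
    (f := Complex.exp) (C := Real.exp (max 0 w.re)) (x := 0) (y := w)
    (fun _ _ => Complex.differentiableAt_exp) ?_ (by simp) (by simp)
  · rw [Complex.exp_zero, sub_zero, mul_comm] at h
    refine h.trans ?_
    gcongr
    rcases max_cases 0 w.re with h | h <;> rw [h.1]
    · simp [Real.exp_nonneg]
    · simp
  · intro z hz
    rw [Complex.deriv_exp, Complex.norm_exp, Real.exp_le_exp]
    exact hz

namespace HasLevyStrip

variable {ν : Measure ℝ} {a b : ℝ}

theorem integrable_cexp_sub_one (hν : HasLevyStrip ν a b) {z : ℂ} (hz : z.re ∈ Set.Ioo a b) :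
    Integrable (fun x : ℝ => Complex.exp (z * x) - 1) ν := by
  have h := ((hν.integrable 0 hν.zero_mem).add (hν.integrable _ hz)).const_mul ‖z‖
  refine h.mono' (Continuous.aestronglyMeasurable (by fun_prop)) (ae_of_all _ fun x => ?_)
  refine (Complex.norm_exp_sub_one_le_mul _).trans (le_of_eq ?_)
  simp
  ring

theorem integrable_exp_sub_one (hν : HasLevyStrip ν a b) {s : ℝ} (hs : s ∈ Set.Ioo a b) :
    Integrable (fun x : ℝ => Real.exp (s * x) - 1) ν := by
  have h := (hν.integrable_cexp_sub_one (z := s) (by simpa using hs)).re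
  refine h.congr (ae_of_all _ fun x => ?_)
  simp [← Complex.ofReal_mul, Complex.exp_ofReal_re]

/-- Differentiation under the integral sign: for `re w` between `σ₁` and `σ₂`, `e^{re w · x}` is at
most `e^{σ₁x} + e^{σ₂x}`, whatever the sign of `x`. -/
theorem hasDerivAt_levyExponent (hν : HasLevyStrip ν a b) {z : ℂ} (hz : z.re ∈ Set.Ioo a b) :
    HasDerivAt (levyExponent ν) (∫ x : ℝ, x * Complex.exp (z * x) ∂ν) z := by
  obtain ⟨σ₁, ha₁, h₁⟩ := exists_between hz.1
  obtain ⟨σ₂, h₂, hb₂⟩ := exists_between hz.2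
  have hm₁ : σ₁ ∈ Set.Ioo a b := ⟨ha₁, h₁.trans hz.2⟩
  have hm₂ : σ₂ ∈ Set.Ioo a b := ⟨hz.1.trans h₂, hb₂⟩
  have hopen : {w : ℂ | w.re ∈ Set.Ioo σ₁ σ₂} ∈ 𝓝 z :=
    (isOpen_Ioo.preimage Complex.continuous_re).mem_nhds ⟨h₁, h₂⟩
  refine (hasDerivAt_integral_of_dominated_loc_of_deriv_le
    (F := fun (w : ℂ) (x : ℝ) => Complex.exp (w * x) - 1)
    (F' := fun (w : ℂ) (x : ℝ) => x * Complex.exp (w * x))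
    (bound := fun x => |x| * Real.exp (σ₁ * x) + |x| * Real.exp (σ₂ * x)) hopen
    (Eventually.of_forall fun w => Continuous.aestronglyMeasurable (by fun_prop))
    (hν.integrable_cexp_sub_one hz) (Continuous.aestronglyMeasurable (by fun_prop))
    (ae_of_all _ fun x w hw => ?_) ((hν.integrable _ hm₁).add (hν.integrable _ hm₂))
    (ae_of_all _ fun x w hw => ?_)).2
  · rw [norm_mul, Complex.norm_exp, Complex.norm_real, Real.norm_eq_abs, ← mul_add,
      Complex.re_mul_ofReal]
    gcongr
    rcases le_total 0 x with hx | hx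
    · have : Real.exp (w.re * x) ≤ Real.exp (σ₂ * x) :=
        Real.exp_le_exp.mpr (mul_le_mul_of_nonneg_right hw.2.le hx)
      linarith [Real.exp_pos (σ₁ * x)]
    · have : Real.exp (w.re * x) ≤ Real.exp (σ₁ * x) :=
        Real.exp_le_exp.mpr (mul_le_mul_of_nonpos_right hw.1.le hx)
      linarith [Real.exp_pos (σ₂ * x)]
  · have h := ((hasDerivAt_id w).mul_const (x : ℂ)).cexp.sub_const 1
    simpa [mul_comm] using h

/-- Only the real part of the exponent matters, and `re (e^{zx}) ≤ e^{re z · x}`. With `re z`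
between `0` and `s`, the number `e^{re z · x} - 1` is either nonpositive or at most `e^{sx} - 1`, so
the bound is uniform in `im z`. -/
theorem norm_exp_levyExponent_le (hν : HasLevyStrip ν a b) {s : ℝ} (hs : s ∈ Set.Ioo a b)
    {z : ℂ} (hz : z.re ∈ Set.uIcc 0 s) :
    ‖Complex.exp (levyExponent ν z)‖ ≤ Real.exp (∫ x, |Real.exp (s * x) - 1| ∂ν) := by
  have hz' : z.re ∈ Set.Ioo a b := Set.ordConnected_Ioo.uIcc_subset hν.zero_mem hs hz
  rw [Complex.norm_exp, Real.exp_le_exp, levyExponent]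
  have h := hν.integrable_cexp_sub_one hz'
  have : (∫ x : ℝ, (Complex.exp (z * x) - 1) ∂ν).re = ∫ x : ℝ, (Complex.exp (z * x) - 1).re ∂ν :=
    (integral_re h).symm
  rw [this]
  refine integral_mono h.re (hν.integrable_exp_sub_one hs).abs fun x => ?_
  have h1 : (Complex.exp (z * x) - 1).re ≤ Real.exp (z.re * x) - 1 := by
    rw [Complex.sub_re, Complex.one_re, ← Complex.re_mul_ofReal, ← Complex.norm_exp]
    gcongr
    exact Complex.re_le_norm _
  refine h1.trans ?_
  rcases Set.mem_uIcc.mp hz with ⟨h0, h2⟩ | ⟨h2, h0⟩ <;> rcases le_total 0 x with hx | hx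
  · exact le_abs_self _ |>.trans' (by gcongr)
  · refine (sub_nonpos.mpr (Real.exp_le_one_iff.mpr ?_)).trans (abs_nonneg _)
    exact mul_nonpos_of_nonneg_of_nonpos h0 hx
  · refine (sub_nonpos.mpr (Real.exp_le_one_iff.mpr ?_)).trans (abs_nonneg _)
    exact mul_nonpos_of_nonpos_of_nonneg h0 hx
  · refine le_abs_self _ |>.trans' ?_
    gcongr 1
    exact Real.exp_le_exp.mpr (mul_le_mul_of_nonpos_right h2 hx)

theorem levyExponent_ofReal (s : ℝ) :
    levyExponent ν s = ((∫ x, (Real.exp (s * x) - 1) ∂ν : ℝ) : ℂ) := by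
  rw [levyExponent, ← integral_complex_ofReal]
  simp

/-- Exponential moments of a law with characteristic function of Lévy–Khintchine form. -/
theorem integrable_exp_mul (hν : HasLevyStrip ν a b) {μ : Measure ℝ} [IsProbabilityMeasure μ]
    (hμ : ∀ u : ℝ, charFun μ u = Complex.exp (levyExponent ν (u * Complex.I))) {s : ℝ}
    (hs : s ∈ Set.Ioo a b) :
    Integrable (fun x => Real.exp (s * x)) μ ∧
      ∫ x, Real.exp (s * x) ∂μ = Real.exp (∫ x, (Real.exp (s * x) - 1) ∂ν) := by
  have hd : DifferentiableOn ℂ (fun z => Complex.exp (levyExponent ν z))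
      {z | z.re ∈ Set.uIcc 0 s} := fun z hz =>
    (hν.hasDerivAt_levyExponent (Set.ordConnected_Ioo.uIcc_subset hν.zero_mem hs
      hz)).cexp.differentiableAt.differentiableWithinAt
  obtain ⟨h1, h2⟩ := integrable_exp_mul_of_charFun_extension hd
    (fun z hz => hν.norm_exp_levyExponent_le hs hz) hμ
  refine ⟨h1, ?_⟩
  rw [levyExponent_ofReal] at h2
  exact_mod_cast h2

end HasLevyStrip

/-! ### The Lévy measure of the exponentially weighted integral -/

noncomputable section

/-- The Lévy measure of `∫₀ᵗ exp (-b (t - r)) dL(r)` when `ν` is the Lévy measure of `L`. -/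
def ouLevyMeasure (ν : Measure ℝ) (b t : ℝ) : Measure ℝ :=
  (ν.prod (volume.restrict (Set.Ioc 0 t))).map fun p => Real.exp (-b * p.2) * p.1

end

namespace HasLevyStrip

variable {ν : Measure ℝ} {a₁ a₂ b t : ℝ}

theorem exp_mul_mul_le {θ : ℝ} (h0 : 0 ≤ θ) (h1 : θ ≤ 1) (x : ℝ) :
    Real.exp (θ * x) ≤ 1 + Real.exp x := by
  rcases le_total 0 x with hx | hx
  · have : Real.exp (θ * x) ≤ Real.exp x := Real.exp_le_exp.mpr (by nlinarith)
    linarith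
  · have : Real.exp (θ * x) ≤ 1 := Real.exp_le_one_iff.mpr (by nlinarith)
    linarith [Real.exp_pos x]

/-- The kernel takes values in `(0, 1]`, so jumps only shrink and the strip is preserved. -/
theorem ouLevyMeasure [SFinite ν] (hν : HasLevyStrip ν a₁ a₂) (hb : 0 < b) :
    HasLevyStrip (ouLevyMeasure ν b t) a₁ a₂ := by
  refine ⟨hν.zero_mem, fun σ hσ => ?_⟩
  rw [_root_.ouLevyMeasure, integrable_map_measure (by fun_prop) (by fun_prop)]
  have h := ((hν.integrable 0 hν.zero_mem).add (hν.integrable σ hσ)).comp_fst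
    (volume.restrict (Set.Ioc 0 t))
  refine h.mono' (by fun_prop) ?_
  have hmem : ∀ᵐ p ∂(ν.prod (volume.restrict (Set.Ioc 0 t))), p.2 ∈ Set.Ioc 0 t :=
    Measure.quasiMeasurePreserving_snd.ae (ae_restrict_mem measurableSet_Ioc)
  filter_upwards [hmem] with p hp
  have h1 : Real.exp (-b * p.2) ≤ 1 := Real.exp_le_one_iff.mpr (by nlinarith [hp.1])
  have h0 := Real.exp_pos (-b * p.2)
  have h2 := exp_mul_mul_le h0.le h1 (σ * p.1)
  simp only [Function.comp_apply, norm_mul, Real.norm_eq_abs, Real.abs_exp, abs_abs, abs_mul,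
    Pi.add_apply, zero_mul, Real.exp_zero]
  rw [mul_left_comm σ]
  calc _ ≤ 1 * |p.1| * (1 + Real.exp (σ * p.1)) := by gcongr
    _ = _ := by ring

theorem levyExponent_ouLevyMeasure [SFinite ν] (hν : HasLevyStrip ν a₁ a₂) (hb : 0 < b)
    (ht : 0 ≤ t) {z : ℂ} (hz : z.re ∈ Set.Ioo a₁ a₂) :
    levyExponent (_root_.ouLevyMeasure ν b t) z
      = ∫ v in (0 : ℝ)..t, levyExponent ν (z * Real.exp (-b * v)) := by
  have hint := (hν.ouLevyMeasure (t := t) hb).integrable_cexp_sub_one hz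
  have hm : Measurable fun p : ℝ × ℝ => Real.exp (-b * p.2) * p.1 := by fun_prop
  rw [_root_.ouLevyMeasure, integrable_map_measure (by fun_prop) hm.aemeasurable] at hint
  simp only [Function.comp_def] at hint
  rw [levyExponent, _root_.ouLevyMeasure, integral_map hm.aemeasurable (by fun_prop),
    integral_prod_symm _ hint, intervalIntegral.integral_of_le ht]
  simp only [levyExponent, Complex.ofReal_mul, mul_assoc]

end HasLevyStrip

/-! ### Pathwise analysis: Riemann sums, càdlàg paths and variation of constants -/

/-- Riemann sums with right endpoints converge for bounded right-continuous integrands. -/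
theorem tendsto_sum_integral_smul_right_endpoint {E : Type*} [NormedAddCommGroup E]
    [NormedSpace ℝ E] [CompleteSpace E] {h : ℝ → E} {w : ℝ → ℝ} {t M : ℝ} (ht : 0 ≤ t)
    (hw : Continuous w) (hM : ∀ s ∈ Set.Icc 0 t, ‖h s‖ ≤ M)
    (hr : ∀ s ∈ Set.Icc 0 t, ContinuousWithinAt h (Set.Ici s) s) :
    Tendsto (fun n : ℕ => ∑ k ∈ Finset.range (n + 1),
        (∫ s in (t * k / (n + 1))..(t * (k + 1 : ℕ) / (n + 1)), w s) •
          h (t * (k + 1 : ℕ) / (n + 1))) atTop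
      (𝓝 (∫ s in (0 : ℝ)..t, w s • h s)) := by
  rcases ht.eq_or_lt with rfl | ht0
  · simp
  -- `r n s` is the right endpoint of the cell containing `s`. It approaches `s` from the right, so
  -- right-continuity of `h` suffices; the ceiling matches cells open on the left.
  set r : ℕ → ℝ → ℝ := fun n s => t * (⌈s * (n + 1) / t⌉₊ : ℕ) / (n + 1) with hrdef
  have hr_eq : ∀ (n k : ℕ), ∀ s ∈ Set.Ioc (t * k / (n + 1)) (t * (k + 1 : ℕ) / (n + 1)),
      r n s = t * (k + 1 : ℕ) / (n + 1) := by
    intro n k s hs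
    have hn : (0 : ℝ) < n + 1 := by positivity
    have hc : ⌈s * (n + 1) / t⌉₊ = k + 1 := by
      rw [Nat.ceil_eq_iff (by omega)]
      constructor
      · rw [lt_div_iff₀ ht0]
        have := (div_lt_iff₀ hn).mp hs.1
        simpa [mul_comm] using this
      · rw [div_le_iff₀ ht0]
        have := (le_div_iff₀ hn).mp hs.2
        simpa [mul_comm] using this
    simp only [hrdef, hc]
  have hle : ∀ (n : ℕ) (s : ℝ), s ≤ r n s := by
    intro n s
    have hn : (0 : ℝ) < n + 1 := by positivity
    rw [hrdef, le_div_iff₀ hn, mul_comm t, ← div_le_iff₀ ht0]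
    exact Nat.le_ceil _
  have hlt : ∀ (n : ℕ) (s : ℝ), 0 ≤ s → r n s ≤ s + t / (n + 1) := by
    intro n s hs
    have hn : (0 : ℝ) < n + 1 := by positivity
    have h1 := (Nat.ceil_lt_add_one (a := s * (n + 1) / t) (by positivity)).le
    calc r n s ≤ t * (s * (n + 1) / t + 1) / (n + 1) := by simp only [hrdef]; gcongr
      _ = _ := by field_simp
  have hrt : ∀ (n : ℕ) (s : ℝ), s ≤ t → r n s ≤ t := by
    intro n s hs
    have hn : (0 : ℝ) < n + 1 := by positivity
    rw [hrdef, div_le_iff₀ hn]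
    gcongr
    have : ⌈s * (n + 1) / t⌉₊ ≤ n + 1 := by
      rw [Nat.ceil_le, div_le_iff₀ ht0]
      push_cast
      nlinarith
    exact_mod_cast this
  -- No measurability of `h` is needed: the step function factors through `ℕ`.
  have hmeas : ∀ n, StronglyMeasurable fun s => h (r n s) := by
    intro n
    have h1 : StronglyMeasurable fun k : ℕ => h (t * k / (n + 1)) := StronglyMeasurable.of_discrete
    exact h1.comp_measurable (g := fun s : ℝ => ⌈s * (n + 1) / t⌉₊)
      (Nat.measurable_ceil.comp (by fun_prop))
  have hbd : ∀ n, ∀ s ∈ Set.uIoc 0 t, ‖w s • h (r n s)‖ ≤ |w s| * M := by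
    intro n s hs
    rw [Set.uIoc_of_le ht] at hs
    rw [norm_smul, Real.norm_eq_abs]
    gcongr
    exact hM _ ⟨hs.1.le.trans (hle n s), hrt n s hs.2⟩
  have hbi : IntervalIntegrable (fun s => |w s| * M) volume 0 t :=
    (hw.abs.mul continuous_const).intervalIntegrable _ _
  have hsm : ∀ n, AEStronglyMeasurable (fun s => w s • h (r n s))
      (volume.restrict (Set.uIoc 0 t)) := fun n =>
    hw.aestronglyMeasurable.smul (hmeas n).aestronglyMeasurable
  have hlim : Tendsto (fun n : ℕ => ∫ s in (0 : ℝ)..t, w s • h (r n s)) atTop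
      (𝓝 (∫ s in (0 : ℝ)..t, w s • h s)) := by
    refine intervalIntegral.tendsto_integral_filter_of_dominated_convergence
      (fun s => |w s| * M) (Eventually.of_forall hsm)
      (Eventually.of_forall fun n => ae_of_all _ (hbd n)) hbi (ae_of_all _ fun s hs => ?_)
    rw [Set.uIoc_of_le ht] at hs
    refine Tendsto.const_smul ?_ (w s)
    refine (hr s ⟨hs.1.le, hs.2⟩).tendsto.comp (tendsto_nhdsWithin_iff.mpr
      ⟨?_, Eventually.of_forall fun n => hle n s⟩)
    refine tendsto_of_tendsto_of_tendsto_of_le_of_le (h := fun n : ℕ => s + t / (n + 1))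
      tendsto_const_nhds ?_ (fun n => hle n s) (fun n => hlt n s hs.1.le)
    have : Tendsto (fun n : ℕ => t / ((n : ℝ) + 1)) atTop (𝓝 0) :=
      Tendsto.const_div_atTop (tendsto_natCast_atTop_atTop.atTop_add tendsto_const_nhds) t
    simpa using this.const_add s
  refine hlim.congr fun n => ?_
  have hn : (0 : ℝ) < n + 1 := by positivity
  have hint : IntervalIntegrable (fun s => w s • h (r n s)) volume 0 t :=
    hbi.mono_fun' (hsm n) ((ae_restrict_mem measurableSet_uIoc).mono (hbd n))
  have hmono : Monotone fun k : ℕ => t * k / ((n : ℝ) + 1) := by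
    intro i j hij
    dsimp only
    gcongr
  have hadj := intervalIntegral.sum_integral_adjacent_intervals (μ := volume)
    (f := fun s => w s • h (r n s)) (a := fun k : ℕ => t * k / ((n : ℝ) + 1)) (n := n + 1) ?_
  · have he : t * ((n + 1 : ℕ) : ℝ) / (n + 1) = t := by push_cast; field_simp
    simp only [he] at hadj
    simp only [Nat.cast_zero, mul_zero, zero_div] at hadj
    rw [← hadj]
    refine Finset.sum_congr rfl fun k _ => ?_
    rw [← intervalIntegral.integral_smul_const]
    refine intervalIntegral.integral_congr_ae (ae_of_all _ fun s hs => ?_)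
    rw [Set.uIoc_of_le (hmono k.le_succ)] at hs
    rw [hr_eq n k s hs]
  · intro k hk
    refine hint.mono_set ?_
    rw [Set.uIcc_of_le (hmono k.le_succ), Set.uIcc_of_le ht]
    refine Set.Icc_subset_Icc (by positivity) ?_
    rw [div_le_iff₀ hn]
    gcongr
    exact_mod_cast hk

/-- Weighted sums of increments of a bounded right-continuous function, by Abel summation. -/
theorem tendsto_sum_mul_increment {l g g' : ℝ → ℝ} {t M : ℝ} (ht : 0 ≤ t)
    (hg : ∀ s, HasDerivAt g (g' s) s) (hg' : Continuous g')
    (hM : ∀ s ∈ Set.Icc 0 t, |l s| ≤ M)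
    (hr : ∀ s ∈ Set.Icc 0 t, ContinuousWithinAt l (Set.Ici s) s) :
    Tendsto (fun n : ℕ => ∑ k ∈ Finset.range (n + 1), g (t * k / (n + 1)) *
        (l (t * (k + 1 : ℕ) / (n + 1)) - l (t * k / (n + 1)))) atTop
      (𝓝 (g t * l t - g 0 * l 0 - ∫ s in (0 : ℝ)..t, g' s * l s)) := by
  refine ((tendsto_sum_integral_smul_right_endpoint ht hg' hM hr).const_sub
    (g t * l t - g 0 * l 0)).congr fun n => ?_
  have hn : (n : ℝ) + 1 ≠ 0 := by positivity
  -- Abel summation: each term is the increment of `g l` minus the increment of `g` times `l` at the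
  -- right endpoint, and the former telescopes.
  have htel := Finset.sum_range_sub
    (fun k : ℕ => g (t * k / (n + 1)) * l (t * k / (n + 1))) (n + 1)
  have he : t * ((n + 1 : ℕ) : ℝ) / (n + 1) = t := by push_cast; field_simp
  simp only [he] at htel
  simp only [Nat.cast_zero, mul_zero, zero_div] at htel
  rw [← htel, ← Finset.sum_sub_distrib]
  refine Finset.sum_congr rfl fun k _ => ?_
  rw [intervalIntegral.integral_eq_sub_of_hasDerivAt (fun s _ => hg s)
    (hg'.intervalIntegrable _ _), smul_eq_mul]
  ring

/-- A càdlàg path is bounded on compact time intervals. -/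
theorem IsCadlagPath.exists_bound {f : ℝ≥0 → ℝ} (hf : IsCadlagPath f) (t : ℝ≥0) :
    ∃ M, ∀ s ∈ Set.Icc 0 t, |f s| ≤ M := by
  refine isCompact_Icc.induction_on (p := fun S => ∃ M, ∀ s ∈ S, |f s| ≤ M) ⟨0, by simp⟩ ?_ ?_ ?_
  · rintro S T hST ⟨M, hM⟩
    exact ⟨M, fun s hs => hM s (hST hs)⟩
  · rintro S T ⟨M, hM⟩ ⟨N, hN⟩
    refine ⟨max M N, ?_⟩
    rintro s (hs | hs)
    exacts [(hM s hs).trans (le_max_left _ _), (hN s hs).trans (le_max_right _ _)]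
  · intro x _
    obtain ⟨hr, l, hl⟩ := hf x
    have h1 := hr.tendsto.abs.eventually (ge_mem_nhds (lt_add_one |f x|))
    have h2 := hl.abs.eventually (ge_mem_nhds (lt_add_one |l|))
    refine ⟨{s | |f s| ≤ max (|l| + 1) (|f x| + 1)}, mem_nhdsWithin_of_mem_nhds ?_,
      _, fun s hs => hs⟩
    -- The left limit bounds `f` just before `x`, right-continuity bounds it at `x` and just after.
    rw [← nhdsLT_sup_nhdsGE, mem_sup]
    exact ⟨h2.mono fun s hs => hs.trans (le_max_left _ _),
      h1.mono fun s hs => hs.trans (le_max_right _ _)⟩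

theorem IsCadlagPath.continuousWithinAt_toNNReal {f : ℝ≥0 → ℝ} (hf : IsCadlagPath f) (s : ℝ) :
    ContinuousWithinAt (fun r : ℝ => f r.toNNReal) (Set.Ici s) s :=
  ContinuousWithinAt.comp (t := Set.Ici s.toNNReal) (hf s.toNNReal).1
    continuous_real_toNNReal.continuousWithinAt fun _ hr => Real.toNNReal_le_toNNReal hr

/-- Variation of constants for the Ornstein–Uhlenbeck equation with additive càdlàg noise. -/
theorem ou_equation_solution {b x₀ : ℝ} (hb : b ≠ 0) {l x : ℝ≥0 → ℝ} (hl : IsCadlagPath l)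
    (hx : ∀ t : ℝ≥0, IntervalIntegrable (fun s : ℝ => x s.toNNReal) volume 0 t ∧
      x t = x₀ - b * (∫ s in (0 : ℝ)..t, x s.toNNReal) + l t) (t : ℝ≥0) :
    x t = x₀ * Real.exp (-b * t) + (l t -
      ∫ s in (0 : ℝ)..t, b * Real.exp (-b * (t - s)) * l s.toNNReal) := by
  have ht : (0 : ℝ) ≤ t := t.coe_nonneg
  set Y : ℝ → ℝ := fun s => ∫ r in (0 : ℝ)..s, x r.toNNReal with hY
  have hxY : ∀ s : ℝ, 0 ≤ s → x s.toNNReal = x₀ - b * Y s + l s.toNNReal := by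
    intro s hs
    have := (hx s.toNNReal).2
    rwa [Real.coe_toNNReal s hs] at this
  have hint := (hx t).1
  have hYc : ContinuousOn Y (Set.uIcc 0 (t : ℝ)) :=
    intervalIntegral.continuousOn_primitive_interval'
      hint Set.left_mem_uIcc
  -- Integrability of the noise path is read off from the equation itself, `l = x - x₀ + b Y`.
  have hlint : IntervalIntegrable (fun s : ℝ => l s.toNNReal) volume 0 t := by
    have h1 : IntervalIntegrable (fun s => x s.toNNReal - x₀ + b * Y s) volume 0 t :=
      (hint.sub intervalIntegrable_const).add (hYc.intervalIntegrable.const_mul b)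
    refine h1.congr fun s hs => ?_
    rw [Set.uIoc_of_le ht] at hs
    simp only [hxY s hs.1.le]
    ring
  have hxr : ∀ s ∈ Set.Ioo (0 : ℝ) t, ContinuousWithinAt (fun r : ℝ => x r.toNNReal)
      (Set.Ioi s) s := by
    intro s hs
    have hYs : ContinuousAt Y s :=
      hYc.continuousAt (by rw [Set.uIcc_of_le ht]; exact Icc_mem_nhds hs.1 hs.2)
    have h1 : ContinuousWithinAt (fun r => x₀ - b * Y r + l r.toNNReal) (Set.Ioi s) s :=
      (continuousAt_const.sub (continuousAt_const.mul hYs)).continuousWithinAt.add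
        ((hl.continuousWithinAt_toNNReal s).mono Set.Ioi_subset_Ici_self)
    exact h1.congr (fun r hr => hxY r (hs.1.trans hr).le) (hxY s hs.1.le)
  have hYd : ∀ s ∈ Set.Ioo (0 : ℝ) t, HasDerivWithinAt Y (x s.toNNReal) (Set.Ioi s) s := by
    intro s hs
    have hsub : Set.uIcc 0 s ⊆ Set.uIcc 0 (t : ℝ) := by
      rw [Set.uIcc_of_le hs.1.le, Set.uIcc_of_le ht]
      exact Set.Icc_subset_Icc_right hs.2.le
    refine (intervalIntegral.integral_hasDerivWithinAt_right (s := Set.Ici s) (t := Set.Ioi s)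
      (hint.mono_set hsub) ?_ (hxr s hs)).mono Set.Ioi_subset_Ici_self
    refine ⟨Set.Ioc 0 t, mem_nhdsWithin_of_mem_nhds (Ioc_mem_nhds hs.1 hs.2), ?_⟩
    exact hint.aestronglyMeasurable
  have hexp : ∀ s, HasDerivAt (fun s : ℝ => Real.exp (b * s)) (Real.exp (b * s) * b) s := by
    intro s
    simpa using ((hasDerivAt_id s).const_mul b).exp
  -- Integrating factor: `e^{bs} Y` has right derivative `e^{bs} (x₀ + l)`. The path may jump, so
  -- only one-sided derivatives of `Y` are available.
  have hftc := intervalIntegral.integral_eq_sub_of_hasDeriv_right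
    (f := fun s => Real.exp (b * s) * Y s)
    (f' := fun s => Real.exp (b * s) * x₀ + Real.exp (b * s) * l s.toNNReal) (a := 0) (b := t)
    ((by fun_prop : Continuous fun s => Real.exp (b * s)).continuousOn.mul hYc) ?_ ?_
  · rw [intervalIntegral.integral_add (Continuous.intervalIntegrable (by fun_prop) _ _)
      (hlint.continuousOn_mul (by fun_prop)), intervalIntegral.integral_mul_const] at hftc
    have he : ∫ s in (0 : ℝ)..t, Real.exp (b * s) = (Real.exp (b * t) - 1) / b := by
      rw [intervalIntegral.integral_eq_sub_of_hasDerivAt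
        (f := fun s => Real.exp (b * s) / b) (fun s _ => by
          simpa [hb] using (hexp s).div_const b)
        (Continuous.intervalIntegrable (by fun_prop) _ _)]
      simp
      ring
    have hY0 : Y 0 = 0 := intervalIntegral.integral_same
    have hsplit : ∫ s in (0 : ℝ)..t, b * Real.exp (-b * (t - s)) * l s.toNNReal
        = b * Real.exp (-b * t) * ∫ s in (0 : ℝ)..t, Real.exp (b * s) * l s.toNNReal := by
      rw [← intervalIntegral.integral_const_mul]
      congr 1; ext s
      rw [show -b * (t - s) = -b * t + b * s by ring, Real.exp_add]
      ring
    rw [he, hY0, mul_zero, sub_zero] at hftc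
    have h1 := hxY t ht
    rw [Real.toNNReal_coe] at h1
    rw [h1, hsplit]
    have hinv : Real.exp (-b * t) * Real.exp (b * t) = 1 := by
      rw [← Real.exp_add]; simp
    have hYt : b * Y t = Real.exp (-b * t) * (b * (Real.exp (b * t) * Y t)) := by
      linear_combination (-(b * Y t)) * hinv
    rw [hYt, ← hftc]
    simp only [neg_mul] at hinv ⊢
    field_simp
    linear_combination (-x₀) * hinv
  · intro s hs
    rw [min_eq_left ht, max_eq_right ht] at hs
    refine ((hexp s).hasDerivWithinAt.mul (hYd s hs)).congr_deriv ?_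
    rw [hxY s hs.1.le]
    ring
  · exact (Continuous.intervalIntegrable (by fun_prop) _ _).add
      (hlint.continuousOn_mul (by fun_prop))

/-! ### Tempered stable Lévy measures and their cumulants -/

noncomputable section

/-- Lévy measure on `(0, ∞)` of a one-sided tempered stable law, with density
`c exp (-β x) / x ^ (1 + α)`. -/
def temperedStableMeasure (c α β : ℝ) : Measure ℝ :=
  (volume.restrict (Set.Ioi 0)).withDensity
    fun x => ENNReal.ofReal (c * Real.exp (-β * x) / x ^ (1 + α))

/-- The Lévy measure of a bilateral classic tempered stable law. -/
def bctsLevyMeasure (αp αn βp βn cp cn : ℝ) : Measure ℝ :=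
  temperedStableMeasure cp αp βp + (temperedStableMeasure cn αn βn).map Neg.neg

instance (c α β : ℝ) : SFinite (temperedStableMeasure c α β) := by
  unfold temperedStableMeasure
  infer_instance

instance (αp αn βp βn cp cn : ℝ) : SFinite (bctsLevyMeasure αp αn βp βn cp cn) := by
  unfold bctsLevyMeasure
  infer_instance

end

section TemperedStable

variable {E : Type*} [NormedAddCommGroup E] [NormedSpace ℝ E] {c α β : ℝ}

theorem measurable_temperedStable_density (c α β : ℝ) :
    Measurable fun x : ℝ => ENNReal.ofReal (c * Real.exp (-β * x) / x ^ (1 + α)) := by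
  fun_prop

theorem temperedStable_density_toReal (hc : 0 ≤ c) {x : ℝ} (hx : 0 < x) :
    (ENNReal.ofReal (c * Real.exp (-β * x) / x ^ (1 + α))).toReal
      = c * Real.exp (-β * x) / x ^ (1 + α) :=
  ENNReal.toReal_ofReal (by positivity)

theorem integral_temperedStableMeasure (hc : 0 ≤ c) (f : ℝ → E) :
    ∫ x, f x ∂(temperedStableMeasure c α β)
      = ∫ x in Set.Ioi 0, (c * Real.exp (-β * x) / x ^ (1 + α)) • f x := by
  rw [temperedStableMeasure, integral_withDensity_eq_integral_toReal_smul
    (measurable_temperedStable_density c α β) (ae_of_all _ fun x => ENNReal.ofReal_lt_top)]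
  refine setIntegral_congr_fun measurableSet_Ioi fun x hx => ?_
  simp only [temperedStable_density_toReal hc hx]

theorem integrable_temperedStableMeasure_iff (hc : 0 ≤ c) (f : ℝ → E) :
    Integrable f (temperedStableMeasure c α β) ↔
      IntegrableOn (fun x => (c * Real.exp (-β * x) / x ^ (1 + α)) • f x) (Set.Ioi 0) := by
  rw [temperedStableMeasure, integrable_withDensity_iff_integrable_smul'
    (measurable_temperedStable_density c α β) (ae_of_all _ fun x => ENNReal.ofReal_lt_top)]
  refine integrableOn_congr_fun (fun x hx => ?_) measurableSet_Ioi
  simp only [temperedStable_density_toReal hc hx]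

/-- One factor `x` turns the density into a Gamma integrand of shape `1 - α` and rate `β - s`,
integrable exactly because `α < 1` and `s < β`. -/
theorem temperedStable_density_mul_self {s x : ℝ} (hx : 0 < x) :
    c * Real.exp (-β * x) / x ^ (1 + α) * (x * Real.exp (s * x))
      = c * (x ^ (1 - α - 1) * Real.exp (-((β - s) * x))) := by
  have h1 : Real.exp (-((β - s) * x)) = Real.exp (-β * x) * Real.exp (s * x) := by
    rw [← Real.exp_add]; ring_nf
  have h2 : x ^ (1 - α - 1) * x ^ (1 + α) = x := by
    rw [← Real.rpow_add hx, show 1 - α - 1 + (1 + α) = 1 by ring, Real.rpow_one]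
  have h3 := Real.rpow_pos_of_pos hx (1 + α)
  rw [h1]
  field_simp
  linear_combination (-c) * h2

theorem hasLevyStrip_temperedStableMeasure (hc : 0 ≤ c) (hα : α < 1) (hβ : 0 < β) {a : ℝ}
    (ha : a < 0) : HasLevyStrip (temperedStableMeasure c α β) a β := by
  refine ⟨⟨ha, hβ⟩, fun σ hσ => ?_⟩
  rw [integrable_temperedStableMeasure_iff hc]
  have h := (integrableOn_rpow_mul_exp_neg_mul_rpow (p := 1) (s := 1 - α - 1) (b := β - σ)
    (by linarith) one_pos (by linarith [hσ.2])).const_mul c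
  refine (integrableOn_congr_fun (fun x hx => ?_) measurableSet_Ioi).mp h
  rw [smul_eq_mul, abs_of_pos hx, temperedStable_density_mul_self hx, Real.rpow_one, neg_mul]

/-- The cumulant generating function of a one-sided tempered stable law. -/
theorem integral_exp_sub_one_temperedStableMeasure (hc : 0 ≤ c) (hα : α < 1) (hα0 : α ≠ 0)
    (hβ : 0 < β) {s : ℝ} (hs : s < β) :
    ∫ x, (Real.exp (s * x) - 1) ∂(temperedStableMeasure c α β)
      = -(c * Real.Gamma (1 - α) / α) * ((β - s) ^ α - β ^ α) := by
  -- The measure lives on `(0, ∞)`, so its strip extends arbitrarily far to the left; it is taken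
  -- wide enough to contain both `0` and `s`.
  obtain ⟨a, ha⟩ := exists_lt (min 0 s)
  have ha0 : a < 0 := ha.trans_le (min_le_left _ _)
  have hν := hasLevyStrip_temperedStableMeasure (c := c) hc hα hβ ha0
  set ν := temperedStableMeasure c α β
  have hderiv : ∀ r ∈ Set.Ioo a β, HasDerivAt (fun r : ℝ => ∫ x, (Real.exp (r * x) - 1) ∂ν)
      (c * Real.Gamma (1 - α) * (β - r) ^ (α - 1)) r := by
    intro r hr
    have h1 := (hν.hasDerivAt_levyExponent (z := r) (by simpa using hr)).real_of_complex
    have h2 : (∫ x : ℝ, (x : ℂ) * Complex.exp (r * x) ∂ν)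
        = ((c * Real.Gamma (1 - α) * (β - r) ^ (α - 1) : ℝ) : ℂ) := by
      have : ∀ x : ℝ, (x : ℂ) * Complex.exp (r * x) = ((x * Real.exp (r * x) : ℝ) : ℂ) := by
        intro x; push_cast; rfl
      simp_rw [this]
      rw [integral_complex_ofReal, integral_temperedStableMeasure hc]
      congr 1
      rw [setIntegral_congr_fun (g := fun x => c * (x ^ (1 - α - 1) *
        Real.exp (-((β - r) * x)))) measurableSet_Ioi fun x hx => by
          rw [smul_eq_mul, temperedStable_density_mul_self hx],
        integral_const_mul, Real.integral_rpow_mul_exp_neg_mul_Ioi (by linarith)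
          (by linarith [hr.2]), one_div, Real.inv_rpow (by linarith [hr.2]),
        ← Real.rpow_neg (by linarith [hr.2])]
      ring_nf
    rw [h2, Complex.ofReal_re] at h1
    simpa only [HasLevyStrip.levyExponent_ofReal, Complex.ofReal_re] using h1
  have hderiv' : ∀ r ∈ Set.Ioo a β, HasDerivAt
      (fun r : ℝ => -(c * Real.Gamma (1 - α) / α) * ((β - r) ^ α - β ^ α))
      (c * Real.Gamma (1 - α) * (β - r) ^ (α - 1)) r := by
    intro r hr
    have h1 := ((((hasDerivAt_id r).const_sub β).rpow_const (p := α)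
      (Or.inl (by simpa [sub_eq_zero] using hr.2.ne'))).sub_const (β ^ α)).const_mul
        (-(c * Real.Gamma (1 - α) / α))
    refine h1.congr_deriv ?_
    simp only [id]
    field_simp
  -- Both sides have the same derivative on the strip and vanish at `0`.
  have heq := isOpen_Ioo.eqOn_of_deriv_eq isPreconnected_Ioo
    (fun r hr => (hderiv r hr).differentiableAt.differentiableWithinAt)
    (fun r hr => (hderiv' r hr).differentiableAt.differentiableWithinAt)
    (fun r hr => by rw [(hderiv r hr).deriv, (hderiv' r hr).deriv]) hν.zero_mem (by simp)
  exact heq ⟨ha.trans_le (min_le_right _ _), hs⟩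

end TemperedStable

/-! ### The two-sided measure -/

section Bcts

variable {αp αn βp βn cp cn : ℝ}

theorem HasLevyStrip.map_neg {ν : Measure ℝ} {a b : ℝ} (hν : HasLevyStrip ν a b) :
    HasLevyStrip (ν.map Neg.neg) (-b) (-a) := by
  refine ⟨by simpa using hν.zero_mem.symm, fun σ hσ => ?_⟩
  rw [integrable_map_measure (by fun_prop) (by fun_prop)]
  refine (hν.integrable (-σ) ⟨by linarith [hσ.2], by linarith [hσ.1]⟩).congr
    (ae_of_all _ fun x => ?_)
  simp

theorem HasLevyStrip.add {ν ν' : Measure ℝ} {a b : ℝ} (hν : HasLevyStrip ν a b)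
    (hν' : HasLevyStrip ν' a b) : HasLevyStrip (ν + ν') a b :=
  ⟨hν.zero_mem, fun σ hσ => (hν.integrable σ hσ).add_measure (hν'.integrable σ hσ)⟩

theorem hasLevyStrip_bctsLevyMeasure (hcp : 0 ≤ cp) (hcn : 0 ≤ cn) (hαp : αp < 1) (hαn : αn < 1)
    (hβp : 0 < βp) (hβn : 0 < βn) :
    HasLevyStrip (bctsLevyMeasure αp αn βp βn cp cn) (-βn) βp := by
  refine (hasLevyStrip_temperedStableMeasure hcp hαp hβp (by linarith)).add ?_
  -- The free left endpoint is chosen as `-βp` so that reflection produces the strip of the positive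
  -- part.
  have := (hasLevyStrip_temperedStableMeasure hcn hαn hβn (a := -βp) (by linarith)).map_neg
  rwa [neg_neg] at this

theorem levyExponent_map_neg (ν : Measure ℝ) (z : ℂ) :
    levyExponent (ν.map Neg.neg) z = levyExponent ν (-z) := by
  rw [levyExponent, integral_map (by fun_prop) (by fun_prop)]
  simp [levyExponent]

theorem HasLevyStrip.levyExponent_add {ν ν' : Measure ℝ} {a b : ℝ} (hν : HasLevyStrip ν a b)
    (hν' : HasLevyStrip ν' a b) {z : ℂ} (hz : z.re ∈ Set.Ioo a b) :
    levyExponent (ν + ν') z = levyExponent ν z + levyExponent ν' z :=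
  integral_add_measure (hν.integrable_cexp_sub_one hz) (hν'.integrable_cexp_sub_one hz)

theorem levyExponent_bctsLevyMeasure (hcp : 0 ≤ cp) (hcn : 0 ≤ cn) (hαp : αp < 1) (hαn : αn < 1)
    (hβp : 0 < βp) (hβn : 0 < βn) {z : ℂ} (hz : z.re ∈ Set.Ioo (-βn) βp) :
    levyExponent (bctsLevyMeasure αp αn βp βn cp cn) z
      = levyExponent (temperedStableMeasure cp αp βp) z
        + levyExponent (temperedStableMeasure cn αn βn) (-z) := by
  have := (hasLevyStrip_temperedStableMeasure hcn hαn hβn (a := -βp) (by linarith)).map_neg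
  rw [neg_neg] at this
  rw [bctsLevyMeasure, (hasLevyStrip_temperedStableMeasure hcp hαp hβp
    (by linarith)).levyExponent_add this hz, levyExponent_map_neg]

theorem bctsExponent_eq_levyExponent (hcp : 0 ≤ cp) (hcn : 0 ≤ cn) (hαp : αp < 1) (hαn : αn < 1)
    (hβp : 0 < βp) (hβn : 0 < βn) (u : ℝ) :
    bctsExponent αp αn βp βn cp cn u
      = levyExponent (bctsLevyMeasure αp αn βp βn cp cn) (u * Complex.I) := by
  rw [levyExponent_bctsLevyMeasure hcp hcn hαp hαn hβp hβn (by simp [hβp, hβn]), bctsExponent]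
  set f : ℝ → ℂ := fun x => (Complex.exp (Complex.I * u * x) - 1) *
    (bctsLevyDensity αp αn βp βn cp cn x : ℂ) with hf
  have hpos : Set.EqOn (fun x : ℝ => (cp * Real.exp (-βp * x) / x ^ (1 + αp)) •
      (Complex.exp (u * Complex.I * x) - 1)) f (Set.Ioi 0) := by
    intro x hx
    have hx0 : (0 : ℝ) < x := hx
    simp only [hf, bctsLevyDensity, if_pos hx0]
    rw [Complex.real_smul, mul_comm, mul_comm Complex.I]
  have hneg : Set.EqOn (fun x : ℝ => (cn * Real.exp (-βn * x) / x ^ (1 + αn)) •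
      (Complex.exp (-(u * Complex.I) * x) - 1)) (fun x => f (-x)) (Set.Ioi 0) := by
    intro x hx
    have hx0 : (0 : ℝ) < x := hx
    simp only [hf, bctsLevyDensity, if_neg (by linarith : ¬ 0 < -x),
      if_pos (by linarith : -x < 0), abs_neg, abs_of_pos hx0]
    rw [Complex.real_smul, mul_comm, mul_comm Complex.I]
    simp
  have hip : IntegrableOn f (Set.Ioi 0) := by
    have h := (hasLevyStrip_temperedStableMeasure hcp hαp hβp
      neg_one_lt_zero).integrable_cexp_sub_one (z := u * Complex.I) (by simp [hβp])
    rw [integrable_temperedStableMeasure_iff hcp] at h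
    exact (integrableOn_congr_fun hpos measurableSet_Ioi).mp h
  have hin : IntegrableOn f (Set.Iic 0) := by
    have h := (hasLevyStrip_temperedStableMeasure hcn hαn hβn
      neg_one_lt_zero).integrable_cexp_sub_one (z := -(u * Complex.I)) (by simp [hβn])
    rw [integrable_temperedStableMeasure_iff hcn] at h
    have h' := ((integrableOn_congr_fun hneg measurableSet_Ioi).mp h).comp_neg
    simpa [integrableOn_Iic_iff_integrableOn_Iio] using h'
  rw [← intervalIntegral.integral_Iic_add_Ioi hin hip, add_comm, levyExponent, levyExponent,
    integral_temperedStableMeasure hcp, integral_temperedStableMeasure hcn,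
    setIntegral_congr_fun measurableSet_Ioi hpos, setIntegral_congr_fun measurableSet_Ioi hneg,
    integral_comp_neg_Ioi, neg_zero]

end Bcts

/-! ### The integral `tildeI` -/

section TildeI

/-- Substitute `z = β e^{bv}`. Since `z - s = e^{bv} (β - s e^{-bv})`, all powers of `e^{bv}` cancel
against `dz = b β e^{bv} dv`. -/
theorem tildeI_eq_integral_exp {s α β b t : ℝ} (hβ : 0 < β) (hs : s < β) (hb : 0 < b)
    (ht : 0 ≤ t) :
    tildeI s α β (β / Real.exp (-b * t))
      = b * β ^ (-α) * ∫ v in (0 : ℝ)..t, (β - s * Real.exp (-b * v)) ^ α := by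
  have hexp : ∀ v ∈ Set.uIcc 0 t, HasDerivAt (fun v : ℝ => β * Real.exp (b * v))
      (β * (Real.exp (b * v) * b)) v := by
    intro v _
    simpa using (((hasDerivAt_id v).const_mul b).exp.const_mul β)
  have hge : ∀ v ∈ Set.uIcc 0 t, β ≤ β * Real.exp (b * v) := by
    intro v hv
    rw [Set.uIcc_of_le ht] at hv
    have := Real.one_le_exp (mul_nonneg hb.le hv.1)
    nlinarith
  have h := intervalIntegral.integral_comp_mul_deriv' (g := fun z => z ^ (-1 - α) * (z - s) ^ α)
    hexp (by fun_prop) ?_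
  · have he : β / Real.exp (-b * t) = β * Real.exp (b * t) := by
      rw [neg_mul, Real.exp_neg, div_inv_eq_mul]
    rw [tildeI, he]
    simp only [mul_zero, Real.exp_zero, mul_one] at h
    rw [← h, ← intervalIntegral.integral_const_mul]
    refine intervalIntegral.integral_congr fun v hv => ?_
    have hge' := hge v hv
    have hE := Real.exp_pos (b * v)
    have hz : 0 < β * Real.exp (b * v) := by positivity
    have hinv : Real.exp (b * v) * Real.exp (-b * v) = 1 := by
      rw [← Real.exp_add]; simp
    have hfac : β * Real.exp (b * v) - s = Real.exp (b * v) * (β - s * Real.exp (-b * v)) := by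
      linear_combination s * hinv
    have hpos : 0 < β - s * Real.exp (-b * v) := by
      refine pos_of_mul_pos_right (a := Real.exp (b * v)) ?_ hE.le
      rw [← hfac]; linarith
    simp only [Function.comp_apply]
    rw [hfac, Real.mul_rpow hE.le hpos.le, Real.mul_rpow hβ.le hE.le, sub_eq_add_neg,
      Real.rpow_add hβ, Real.rpow_add hE, Real.rpow_neg_one, Real.rpow_neg_one,
      Real.rpow_neg hE.le α]
    have h1 := Real.rpow_pos_of_pos hE α
    field_simp
  · rintro z ⟨v, hv, rfl⟩
    have hge' := hge v hv
    refine ContinuousAt.continuousWithinAt ?_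
    refine ContinuousAt.mul (Real.continuousAt_rpow_const _ _ (Or.inl ?_))
      ((continuousAt_id.sub continuousAt_const).rpow_const (Or.inl ?_))
    · exact (hβ.trans_le hge').ne'
    · exact (sub_pos.mpr (hs.trans_le hge')).ne'

/-- Time integral of the one-sided tempered stable cumulant along the exponential kernel. -/
theorem integral_temperedStable_cumulant {c s α β b t : ℝ} (hα0 : α ≠ 0) (hβ : 0 < β)
    (hs : s < β) (hb : 0 < b) (ht : 0 ≤ t) :
    ∫ v in (0 : ℝ)..t, -(c * Real.Gamma (1 - α) / α) *
        ((β - s * Real.exp (-b * v)) ^ α - β ^ α)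
      = -(c * β ^ α * Real.Gamma (1 - α) / (α * b)) *
        (tildeI s α β (β / Real.exp (-b * t)) + Real.log (Real.exp (-b * t))) := by
  have hpos : ∀ v ∈ Set.uIcc 0 t, 0 < β - s * Real.exp (-b * v) := by
    intro v hv
    rw [Set.uIcc_of_le ht] at hv
    have h1 : Real.exp (-b * v) ≤ 1 := Real.exp_le_one_iff.mpr (by nlinarith [hv.1])
    have h0 := Real.exp_pos (-b * v)
    rcases le_total 0 s with h | h <;> nlinarith
  have hint : IntervalIntegrable (fun v => (β - s * Real.exp (-b * v)) ^ α) volume 0 t := by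
    refine ContinuousOn.intervalIntegrable ?_
    exact ContinuousOn.rpow_const (by fun_prop) fun v hv => Or.inl (hpos v hv).ne'
  -- The constant `β^α` integrates to `t β^α`; with `log a = -b t` this is the logarithmic term of
  -- the formula.
  rw [intervalIntegral.integral_const_mul, intervalIntegral.integral_sub hint
    intervalIntegrable_const, intervalIntegral.integral_const, tildeI_eq_integral_exp hβ hs hb ht,
    Real.log_exp, Real.rpow_neg hβ.le, smul_eq_mul]
  have := Real.rpow_pos_of_pos hβ α
  field_simp
  ring

/-- The logarithm has derivative `1 / (2 √z √(z - ε))` and the root `ε / (2 z √z √(z - ε))`; twice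
the difference is `√(z - ε) / (z √z)`. -/
theorem hasDerivAt_tildeI_half_primitive {ε z : ℝ} (hz : 0 < z)
    (hzε : 0 < z - ε) :
    HasDerivAt (fun z => 2 * (Real.log (√z + √(z - ε)) - √((z - ε) / z)))
      (z ^ (-1 - 1 / 2 : ℝ) * (z - ε) ^ (1 / 2 : ℝ)) z := by
  have h1 := (hasDerivAt_id z).sqrt hz.ne'
  have h2 := ((hasDerivAt_id z).sub_const ε).sqrt hzε.ne'
  have h3 := (((hasDerivAt_id z).sub_const ε).div (hasDerivAt_id z) hz.ne').sqrt
    (div_pos hzε hz).ne'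
  have hA : 0 < √z := Real.sqrt_pos.mpr hz
  have hB : 0 < √(z - ε) := Real.sqrt_pos.mpr hzε
  have hA2 : √z ^ 2 = z := Real.sq_sqrt hz.le
  have hB2 : √(z - ε) ^ 2 = z - ε := Real.sq_sqrt hzε.le
  have h := (((h1.add h2).log (add_pos hA hB).ne').sub h3).const_mul 2
  refine h.congr_deriv ?_
  have hp : z ^ (-1 - 1 / 2 : ℝ) = (z * √z)⁻¹ := by
    rw [show (-1 - 1 / 2 : ℝ) = -(1 + 1 / 2) by ring, Real.rpow_neg hz.le, Real.rpow_add hz,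
      Real.rpow_one, ← Real.sqrt_eq_rpow]
  rw [hp, ← Real.sqrt_eq_rpow]
  simp only [id, Pi.div_apply, Pi.add_apply]
  rw [Real.sqrt_div hzε.le]
  have hzA : ε = √z ^ 2 - √(z - ε) ^ 2 := by rw [hA2, hB2]; ring
  generalize √(z - ε) = B at *
  generalize √z = A at *
  subst hA2
  have : A + B ≠ 0 := by positivity
  field_simp
  subst hzA
  ring

theorem tildeI_half {ε β₁ β₂ : ℝ} (h₁ : max 0 ε < β₁) (h₂ : max 0 ε < β₂) :
    tildeI ε (1 / 2) β₁ β₂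
      = 2 * (Real.log (√β₂ + √(β₂ - ε)) - √((β₂ - ε) / β₂))
        - 2 * (Real.log (√β₁ + √(β₁ - ε)) - √((β₁ - ε) / β₁)) := by
  have hmem : ∀ z ∈ Set.uIcc β₁ β₂, 0 < z ∧ 0 < z - ε := by
    intro z hz
    have := (lt_min h₁ h₂).trans_le hz.1
    exact ⟨(le_max_left _ _).trans_lt this, sub_pos.mpr ((le_max_right _ _).trans_lt this)⟩
  rw [tildeI]
  refine intervalIntegral.integral_eq_sub_of_hasDerivAt
    (f := fun z => 2 * (Real.log (√z + √(z - ε)) - √((z - ε) / z))) (fun z hz => ?_)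
    (ContinuousOn.intervalIntegrable ?_)
  · exact hasDerivAt_tildeI_half_primitive (hmem z hz).1 (hmem z hz).2
  · exact (ContinuousOn.rpow_const (by fun_prop) fun z hz => Or.inl (hmem z hz).1.ne').mul
      (ContinuousOn.rpow_const (by fun_prop) fun z hz => Or.inl (hmem z hz).2.ne')

end TildeI

/-! ### The law of the Ornstein–Uhlenbeck process -/

section OrnsteinUhlenbeck

variable {Ω : Type*} [MeasurableSpace Ω] {P : Measure Ω}
  {αp αn βp βn cp cn b x₀ : ℝ} {L X : ℝ≥0 → Ω → ℝ}

/-- Characteristic function of a weighted sum of increments over a uniform partition. -/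
theorem IsBCTSLevyProcess.charFun_sum_increments
    (hL : IsBCTSLevyProcess P αp αn βp βn cp cn L) (t : ℝ≥0) (n : ℕ) (g : ℕ → ℝ) (u : ℝ) :
    charFun (P.map fun ω => ∑ k ∈ Finset.range (n + 1), g k *
        (L (t * (k + 1 : ℕ) / (n + 1) : ℝ).toNNReal ω - L (t * k / (n + 1) : ℝ).toNNReal ω)) u
      = Complex.exp (∑ k ∈ Finset.range (n + 1),
          (t / (n + 1) : ℝ) • bctsExponent αp αn βp βn cp cn (g k * u)) := by
  set τ : ℕ → ℝ≥0 := fun k => (t * k / (n + 1) : ℝ).toNNReal with hτ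
  have hmono : Monotone τ := by
    intro i j hij
    refine Real.toNNReal_le_toNNReal ?_
    gcongr
  have hstep : ∀ k, τ (k + 1) = τ k + (t / (n + 1) : ℝ).toNNReal := by
    intro k
    rw [hτ, ← Real.toNNReal_add (by positivity) (by positivity)]
    push_cast
    ring_nf
  have hind := (hL.indep_increments.nat hmono).comp (fun k x => g k * x)
    (fun k => measurable_const_mul _)
  have hinc : ∀ k, AEMeasurable (fun ω => L (τ (k + 1)) ω - L (τ k) ω) P := fun k =>
    (hL.aemeasurable _).sub (hL.aemeasurable _)
  have hprod := (hind.restrict (Finset.range (n + 1))).charFun_map_fun_finsetSum_eq_prod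
    (fun k _ => (hinc k).const_mul (g k))
  rw [Complex.exp_sum]
  refine (congrFun hprod u).trans ?_
  rw [Finset.prod_apply]
  refine Finset.prod_congr rfl fun k _ => ?_
  have hmap : P.map (fun ω => g k * (L (τ (k + 1)) ω - L (τ k) ω))
      = (P.map (L (t / (n + 1) : ℝ).toNNReal)).map (g k * ·) := by
    rw [← Function.comp_def (g k * ·) (fun ω => L (τ (k + 1)) ω - L (τ k) ω), ← AEMeasurable.map_map_of_aemeasurable (by fun_prop) (hinc k), hstep,
      (hL.stationary_increments (τ k) _).map_eq]
  rw [hmap, charFun_map_mul, hL.charFun_eq, Complex.real_smul]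
  congr 2
  exact congrArg Complex.ofReal (Real.coe_toNNReal _ (by positivity))

/-- The Ornstein–Uhlenbeck process is almost surely the limit of weighted sums of increments. -/
theorem IsOUProcess.tendsto_sum_increments (hb : 0 < b)
    (hL : IsBCTSLevyProcess P αp αn βp βn cp cn L) (hX : IsOUProcess P b x₀ L X) (t : ℝ≥0) :
    ∀ᵐ ω ∂P, Tendsto (fun n : ℕ => ∑ k ∈ Finset.range (n + 1),
        Real.exp (-b * (t - t * k / (n + 1))) *
        (L (t * (k + 1 : ℕ) / (n + 1) : ℝ).toNNReal ω - L (t * k / (n + 1) : ℝ).toNNReal ω)) atTop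
      (𝓝 (X t ω - x₀ * Real.exp (-b * t))) := by
  filter_upwards [hL.start_zero, hL.cadlag, hX] with ω h0 hc hx
  obtain ⟨M, hM⟩ := hc.exists_bound t
  -- The boundary terms reduce to `L t`, because the kernel equals `1` at `s = t` and `L` starts at
  -- zero.
  have hlim := tendsto_sum_mul_increment (l := fun s => L s.toNNReal ω)
    (g := fun s => Real.exp (-b * (t - s))) (g' := fun s => b * Real.exp (-b * (t - s)))
    (t := t) (M := M) t.coe_nonneg (fun s => ?_) (by fun_prop) (fun s hs => hM _ ⟨zero_le, ?_⟩)
    (fun s _ => hc.continuousWithinAt_toNNReal s)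
  · convert! hlim using 2
    rw [ou_equation_solution (x := fun t => X t ω) hb.ne' hc hx t]
    simp [h0]
  · refine ((((hasDerivAt_id s).const_sub (t : ℝ)).const_mul (-b)).exp).congr_deriv ?_
    simp [mul_comm]
  · exact Real.toNNReal_le_iff_le_coe.mpr hs.2

/-- The defining equation is only pathwise, so measurability comes from the approximating sums. -/
theorem IsOUProcess.aemeasurable (hb : 0 < b)
    (hL : IsBCTSLevyProcess P αp αn βp βn cp cn L) (hX : IsOUProcess P b x₀ L X) (t : ℝ≥0) :
    AEMeasurable (X t) P := by
  have h := aemeasurable_of_tendsto_metrizable_ae atTop (fun n => ?_)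
    (hX.tendsto_sum_increments hb hL t)
  · simpa using h.add_const (x₀ * Real.exp (-b * t))
  · exact Finset.aemeasurable_fun_sum _ fun k _ =>
      ((hL.aemeasurable _).sub (hL.aemeasurable _)).const_mul _

theorem IsOUProcess.charFun_eq [IsProbabilityMeasure P] (hb : 0 < b) (hψ : Continuous (bctsExponent αp αn βp βn cp cn))
    (hL : IsBCTSLevyProcess P αp αn βp βn cp cn L) (hX : IsOUProcess P b x₀ L X) (t : ℝ≥0)
    (u : ℝ) :
    charFun (P.map fun ω => X t ω - x₀ * Real.exp (-b * t)) u
      = Complex.exp (∫ v in (0 : ℝ)..t,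
          bctsExponent αp αn βp βn cp cn (u * Real.exp (-b * v))) := by
  set S : ℕ → Ω → ℝ := fun n ω => ∑ k ∈ Finset.range (n + 1),
    Real.exp (-b * (t - t * k / (n + 1))) *
    (L (t * (k + 1 : ℕ) / (n + 1) : ℝ).toNNReal ω - L (t * k / (n + 1) : ℝ).toNNReal ω) with hS
  have hSm : ∀ n, AEMeasurable (S n) P := fun n => Finset.aemeasurable_fun_sum _ fun k _ =>
    ((hL.aemeasurable _).sub (hL.aemeasurable _)).const_mul _
  have hcf : ∀ Y : Ω → ℝ, AEMeasurable Y P →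
      charFun (P.map Y) u = ∫ ω, Complex.exp (u * Y ω * Complex.I) ∂P := by
    intro Y hY
    rw [charFun_apply_real, integral_map hY (by fun_prop)]
  have h1 : Tendsto (fun n => charFun (P.map (S n)) u) atTop
      (𝓝 (charFun (P.map fun ω => X t ω - x₀ * Real.exp (-b * t)) u)) := by
    rw [hcf _ ((hX.aemeasurable hb hL t).sub_const _)]
    simp_rw [fun n => hcf (S n) (hSm n)]
    refine tendsto_integral_of_dominated_convergence (fun _ => 1) (fun n => ?_)
      (integrable_const _) (fun n => ae_of_all _ fun ω => ?_) ?_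
    · have hc : Continuous fun x : ℝ => Complex.exp (u * x * Complex.I) := by fun_prop
      exact (hc.measurable.comp_aemeasurable (hSm n)).aestronglyMeasurable
    · rw [← Complex.ofReal_mul, Complex.norm_exp_ofReal_mul_I]
    · filter_upwards [hX.tendsto_sum_increments hb hL t] with ω hω
      have hc : Continuous fun x : ℝ => Complex.exp (u * x * Complex.I) := by fun_prop
      exact (hc.tendsto _).comp hω
  set Ψ : ℝ → ℂ := fun v => bctsExponent αp αn βp βn cp cn (u * Real.exp (-b * v)) with hΨ
  have hΨc : Continuous Ψ := hψ.comp (by fun_prop)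
  obtain ⟨M, hM⟩ := isCompact_Icc.exists_bound_of_continuousOn (s := Set.Icc 0 (t : ℝ))
    hΨc.continuousOn
  have h2 := tendsto_sum_integral_smul_right_endpoint (w := fun _ => 1) t.coe_nonneg
    continuous_const hM (fun s _ => hΨc.continuousWithinAt)
  simp only [one_smul] at h2
  refine tendsto_nhds_unique h1 (((Complex.continuous_exp.tendsto _).comp h2).congr fun n => ?_)
  -- Left endpoints in `s` are right endpoints in the reversed time `v = t - s`; reflecting the sum
  -- gives the node `v = t (k + 1) / (n + 1)`.
  rw [hS, hL.charFun_sum_increments t n (fun k => Real.exp (-b * (t - t * k / (n + 1)))),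
    Function.comp_apply, ← Finset.sum_range_reflect]
  congr 1
  refine Finset.sum_congr rfl fun k hk => ?_
  have hkn : k ≤ n := Nat.lt_succ_iff.mp (Finset.mem_range.mp hk)
  have hn : (n : ℝ) + 1 ≠ 0 := by positivity
  have hidx : n + 1 - 1 - k + 1 = n + 1 - k := by omega
  rw [intervalIntegral.integral_const, hidx]
  have hidx' : n + 1 - 1 - k = n - k := by omega
  rw [hidx', Nat.cast_sub hkn, Nat.cast_sub (hkn.trans n.le_succ), hΨ, smul_eq_mul, mul_one]
  push_cast
  congr 2
  · field_simp
    ring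
  · rw [mul_comm]
    congr 3
    field_simp

end OrnsteinUhlenbeck

/-! ### The cumulant generating function -/

section Cumulant

variable {αp αn βp βn cp cn b s t : ℝ}

theorem continuous_bctsExponent (hcp : 0 ≤ cp) (hcn : 0 ≤ cn) (hαp : αp < 1) (hαn : αn < 1)
    (hβp : 0 < βp) (hβn : 0 < βn) : Continuous (bctsExponent αp αn βp βn cp cn) := by
  have hν := hasLevyStrip_bctsLevyMeasure hcp hcn hαp hαn hβp hβn
  rw [funext (bctsExponent_eq_levyExponent hcp hcn hαp hαn hβp hβn), continuous_iff_continuousAt]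
  intro u
  exact ContinuousAt.comp (f := fun u : ℝ => (u : ℂ) * Complex.I)
    (hν.hasDerivAt_levyExponent (by simp [hβp, hβn])).continuousAt (by fun_prop)

theorem mul_exp_neg_mem_Ioo {a c v : ℝ} (ha : a < 0) (hc : 0 < c) (hs : s ∈ Set.Ioo a c)
    (hb : 0 < b) (hv : 0 ≤ v) : s * Real.exp (-b * v) ∈ Set.Ioo a c := by
  have h1 : Real.exp (-b * v) ≤ 1 := Real.exp_le_one_iff.mpr (by nlinarith)
  have h0 := Real.exp_pos (-b * v)
  constructor <;> rcases le_total 0 s with h | h <;> nlinarith [hs.1, hs.2]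

/-- The cumulant generating function of the noise part of the OU-BCTS process, in terms of its
Lévy measure. -/
theorem integral_exp_sub_one_ouLevyMeasure (hcp : 0 ≤ cp) (hcn : 0 ≤ cn) (hαp : αp < 1)
    (hαn : αn < 1) (hαp0 : αp ≠ 0) (hαn0 : αn ≠ 0) (hβp : 0 < βp) (hβn : 0 < βn) (hb : 0 < b)
    (ht : 0 ≤ t) (hs : s ∈ Set.Ioo (-βn) βp) :
    ∫ x, (Real.exp (s * x) - 1) ∂(ouLevyMeasure (bctsLevyMeasure αp αn βp βn cp cn) b t)
      = ouBctsCgf αp αn βp βn cp cn b s t := by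
  have hν := hasLevyStrip_bctsLevyMeasure hcp hcn hαp hαn hβp hβn
  have hmem : ∀ v ∈ Set.uIcc 0 t, s * Real.exp (-b * v) ∈ Set.Ioo (-βn) βp := by
    intro v hv
    rw [Set.uIcc_of_le ht] at hv
    exact mul_exp_neg_mem_Ioo (by linarith) hβp hs hb hv.1
  -- The time-integral formula is stated for the complex exponent, so the real identity is proved
  -- after embedding in `ℂ`.
  apply Complex.ofReal_injective
  rw [← HasLevyStrip.levyExponent_ofReal, hν.levyExponent_ouLevyMeasure hb ht (by simpa using hs)]
  set Kp : ℝ → ℝ := fun v => -(cp * Real.Gamma (1 - αp) / αp) *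
    ((βp - s * Real.exp (-b * v)) ^ αp - βp ^ αp) with hKp
  set Kn : ℝ → ℝ := fun v => -(cn * Real.Gamma (1 - αn) / αn) *
    ((βn - (-s) * Real.exp (-b * v)) ^ αn - βn ^ αn) with hKn
  have hK : ∀ v ∈ Set.uIcc 0 t, levyExponent (bctsLevyMeasure αp αn βp βn cp cn)
      (s * Real.exp (-b * v)) = ((Kp v + Kn v : ℝ) : ℂ) := by
    intro v hv
    have hv' := hmem v hv
    rw [← Complex.ofReal_mul, levyExponent_bctsLevyMeasure hcp hcn hαp hαn hβp hβn
      (by rwa [Complex.ofReal_re]), ← Complex.ofReal_neg, HasLevyStrip.levyExponent_ofReal,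
      HasLevyStrip.levyExponent_ofReal,
      integral_exp_sub_one_temperedStableMeasure hcp hαp hαp0 hβp hv'.2,
      integral_exp_sub_one_temperedStableMeasure hcn hαn hαn0 hβn (by linarith [hv'.1]),
      ← Complex.ofReal_add]
    simp only [hKp, hKn, neg_mul]
  have hcp' : ContinuousOn Kp (Set.uIcc 0 t) := by
    refine (ContinuousOn.sub (ContinuousOn.rpow_const (by fun_prop) fun v hv => Or.inl ?_)
      continuousOn_const).const_mul _
    linarith [(hmem v hv).2]
  have hcn' : ContinuousOn Kn (Set.uIcc 0 t) := by
    refine (ContinuousOn.sub (ContinuousOn.rpow_const (by fun_prop) fun v hv => Or.inl ?_)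
      continuousOn_const).const_mul _
    linarith [(hmem v hv).1]
  rw [intervalIntegral.integral_congr hK, intervalIntegral.integral_ofReal,
    intervalIntegral.integral_add hcp'.intervalIntegrable hcn'.intervalIntegrable, hKp, hKn,
    integral_temperedStable_cumulant hαp0 hβp hs.2 hb ht,
    integral_temperedStable_cumulant hαn0 hβn (by linarith [hs.1]) hb ht, ouBctsCgf]
  congr 1
  ring

/-- Exponential moments and cumulant generating function of the OU-BCTS process. -/
theorem IsOUProcess.integrable_exp_mul_and_cgf {Ω : Type*} [MeasurableSpace Ω] {P : Measure Ω}
    [IsProbabilityMeasure P] {x₀ : ℝ} {L X : ℝ≥0 → Ω → ℝ} (hcp : 0 ≤ cp) (hcn : 0 ≤ cn)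
    (hαp : αp < 1) (hαn : αn < 1) (hαp0 : αp ≠ 0) (hαn0 : αn ≠ 0) (hβp : 0 < βp) (hβn : 0 < βn)
    (hb : 0 < b) (hL : IsBCTSLevyProcess P αp αn βp βn cp cn L) (hX : IsOUProcess P b x₀ L X)
    (t : ℝ≥0) (hs : s ∈ Set.Ioo (-βn) βp) :
    Integrable (fun ω => Real.exp (s * X t ω)) P ∧
      cgf (X t) P s = s * x₀ * Real.exp (-b * t) + ouBctsCgf αp αn βp βn cp cn b s t := by
  have hν := hasLevyStrip_bctsLevyMeasure hcp hcn hαp hαn hβp hβn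
  set Z : Ω → ℝ := fun ω => X t ω - x₀ * Real.exp (-b * t) with hZ
  have hZm : AEMeasurable Z P := (hX.aemeasurable hb hL t).sub_const _
  have : IsProbabilityMeasure (P.map Z) := Measure.isProbabilityMeasure_map hZm
  have hμ : ∀ u : ℝ, charFun (P.map Z) u = Complex.exp (levyExponent
      (ouLevyMeasure (bctsLevyMeasure αp αn βp βn cp cn) b t) (u * Complex.I)) := by
    intro u
    rw [hX.charFun_eq hb (continuous_bctsExponent hcp hcn hαp hαn hβp hβn) hL,
      hν.levyExponent_ouLevyMeasure hb t.coe_nonneg (by simp [hβp, hβn])]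
    congr 1
    refine intervalIntegral.integral_congr fun v _ => ?_
    simp only [bctsExponent_eq_levyExponent hcp hcn hαp hαn hβp hβn]
    congr 1
    push_cast
    ring
  obtain ⟨h1, h2⟩ := (hν.ouLevyMeasure hb).integrable_exp_mul hμ hs
  rw [integral_exp_sub_one_ouLevyMeasure hcp hcn hαp hαn hαp0 hαn0 hβp hβn hb t.coe_nonneg hs,
    integral_map hZm (by fun_prop)] at h2
  rw [integrable_map_measure (by fun_prop) hZm] at h1
  have hexp : ∀ ω, Real.exp (s * X t ω)
      = Real.exp (s * x₀ * Real.exp (-b * t)) * Real.exp (s * Z ω) := by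
    intro ω
    rw [← Real.exp_add]
    congr 1
    simp only [hZ]
    ring
  constructor
  · simp_rw [hexp]
    exact h1.const_mul _
  · rw [cgf, mgf]
    simp_rw [hexp]
    rw [integral_const_mul, h2, ← Real.exp_add, Real.log_exp]

end Cumulant

/-! ### The risk-neutral drift -/

theorem mainTheorem6 :
    -- the risk-neutral drift in the OU-BCTS spot model
    (∀ {Ω : Type*} [MeasurableSpace Ω] (P : Measure Ω) [IsProbabilityMeasure P]
      (αp αn βp βn cp cn b x₀ : ℝ)
      (_ : αp < 1) (_ : αn < 1) (_ : αp ≠ 0) (_ : αn ≠ 0)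
      (_ : 1 < βp) (_ : 0 < βn) (_ : 0 < cp) (_ : 0 < cn) (_ : 0 < b)
      (L X : ℝ≥0 → Ω → ℝ)
      (_ : IsBCTSLevyProcess P αp αn βp βn cp cn L) (_ : IsOUProcess P b x₀ L X)
      (F₀ h : ℝ≥0 → ℝ) (_ : ∀ t, F₀ t ≠ 0) (t : ℝ≥0),
      -- the cumulant generating function `m_X(s,t) = s x₀ exp (-b t) + m_Z(s,t)`
      (∀ s : ℝ, -βn < s → s < βp →
        Integrable (fun ω => Real.exp (s * X t ω)) P ∧
        cgf (X t) P s
          = s * x₀ * Real.exp (-b * t) + ouBctsCgf αp αn βp βn cp cn b s t) ∧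
      -- consistency with the forward curve: `E[S(t)] = F(0,t)` iff `h(t) = -m_X(1,t)`
      Integrable (spotPrice F₀ h X t) P ∧
      ((∫ ω, spotPrice F₀ h X t ω ∂P = F₀ t) ↔ h t = -cgf (X t) P 1) ∧
      -- the explicit drift, with `a = exp (-b t)`
      ((∫ ω, spotPrice F₀ h X t ω ∂P = F₀ t) ↔
        h t = -(x₀ * Real.exp (-b * t))
          + cp * βp ^ αp * Real.Gamma (1 - αp) / (αp * b) *
            (tildeI 1 αp βp (βp / Real.exp (-b * t)) + Real.log (Real.exp (-b * t)))
          + cn * βn ^ αn * Real.Gamma (1 - αn) / (αn * b) *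
            (tildeI (-1) αn βn (βn / Real.exp (-b * t)) + Real.log (Real.exp (-b * t))))) ∧
    -- the two integrals in closed form for the stability index `1/2`
    (∀ β₁ β₂ : ℝ, 1 < β₁ → 1 < β₂ →
      tildeI 1 (1 / 2) β₁ β₂
        = 2 * (Real.log (√β₂ + √(β₂ - 1)) - √((β₂ - 1) / β₂))
          - 2 * (Real.log (√β₁ + √(β₁ - 1)) - √((β₁ - 1) / β₁))) ∧
    (∀ β₁ β₂ : ℝ, 0 < β₁ → 0 < β₂ →
      tildeI (-1) (1 / 2) β₁ β₂
        = 2 * (Real.log (√β₂ + √(β₂ + 1)) - √((β₂ + 1) / β₂))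
          - 2 * (Real.log (√β₁ + √(β₁ + 1)) - √((β₁ + 1) / β₁))) := by

  refine ⟨?_, fun β₁ β₂ h₁ h₂ => ?_, fun β₁ β₂ h₁ h₂ => ?_⟩
  · intro Ω _ P _ αp αn βp βn cp cn b x₀ hαp hαn hαp0 hαn0 hβp hβn hcp hcn hb L X hL hX F₀ h hF₀ t
    have hβp0 : 0 < βp := by linarith
    have key := fun (s : ℝ) (h1 : -βn < s) (h2 : s < βp) =>
      hX.integrable_exp_mul_and_cgf hcp.le hcn.le hαp hαn hαp0 hαn0 hβp0 hβn hb hL t ⟨h1, h2⟩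
    -- The assumption `βp > 1` is what places `s = 1` inside the strip.
    obtain ⟨hint, hcgf⟩ := key 1 (by linarith) hβp
    have hspot : spotPrice F₀ h X t
        = fun ω => F₀ t * Real.exp (h t) * Real.exp (1 * X t ω) := by
      ext ω
      rw [spotPrice, Real.exp_add, one_mul, mul_assoc]
    have hiff : (∫ ω, spotPrice F₀ h X t ω ∂P = F₀ t) ↔ h t = -cgf (X t) P 1 := by
      have hpos : 0 < mgf (X t) P 1 := mgf_pos hint
      have hval : ∫ ω, spotPrice F₀ h X t ω ∂P
          = F₀ t * Real.exp (h t + cgf (X t) P 1) := by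
        rw [hspot, integral_const_mul, Real.exp_add, cgf, Real.exp_log hpos, mgf, mul_assoc]
      rw [hval, mul_eq_left₀ (hF₀ t), Real.exp_eq_one_iff, eq_neg_iff_add_eq_zero]
    refine ⟨key, ?_, hiff, ?_⟩
    · rw [hspot]
      exact hint.const_mul _
    · rw [hiff, hcgf, ouBctsCgf]
      refine Eq.congr_right ?_
      ring
  · exact tildeI_half (max_lt (one_pos.trans h₁) h₁) (max_lt (one_pos.trans h₂) h₂)
  · have := tildeI_half (ε := -1) (max_lt h₁ (by linarith)) (max_lt h₂ (by linarith))
    simpa only [sub_neg_eq_add] using this
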